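/- Let $\alpha$ be an expanding algebraic number, i.e. every complex root of its minimal polynomial has absolute value greater than $1$. Put $K=\mathbb{Q}(\alpha)$, with ring of integers $\mathcal{O}$, and write $\alpha\mathcal{O}=\mathfrak{a}/\mathfrak{b}$ with coprime ideals $\mathfrak{a},\mathfrak{b}$ of $\mathcal{O}$. Let $$\mathbb{K}_\alpha=\prod_{\mathfrak{p}\mid\infty}K_{\mathfrak{p}}\times\prod_{\mathfrak{p}\mid\mathfrak{b}}K_{\mathfrak{p}},$$ where $\prod_{\mathfrak{p}\mid\infty}K_{\mathfrak{p}}=\mathbb{R}^r\times\mathbb{C}^s$ if $\alpha$ has $r$ real and $s$ pairs of complex Galois conjugates. Let $\mu_\alpha$ be the product of the Lebesgue measures on the factors $\mathbb{R}$ and $\mathbb{C}$ and of the Haar measures on the factors $K_{\mathfrak{p}}$, $\mathfrak{p}\mid\mathfrak{b}$, that give the ring of integers of $K_{\mathfrak{p}}$ measure $1$. Let $\Phi_\alpha:K\to\mathbb{K}_\alpha$ be the diagonal embedding, and let $\alpha$ act on $\mathbb{K}_\alpha$ by multiplication in every component. Let $\mathcal{D}\subset\mathbb{Z}[\alpha]$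 be a standard digit set for $\alpha$, i.e. a complete set of coset representatives of the group $\mathbb{Z}[\alpha]/\alpha\mathbb{Z}[\alpha]$. Then there is a unique non-empty compact set $\mathcal{F}=\mathcal{F}(\alpha,\mathcal{D})\subset\mathbb{K}_\alpha$ with $\alpha\cdot\mathcal{F}=\bigcup_{d\in\mathcal{D}}(\mathcal{F}+\Phi_\alpha(d))$, namely $$\mathcal{F}=\Big\{\sum_{k=1}^{\infty}\Phi_\alpha(d_k\alpha^{-k}) : d_k\in\mathcal{D}\Big\},$$ and $\mu_\alpha(\mathcal{F})>0$, so that $\mathcal{F}$ is a rational self-affine tile. It has the following properties. (i) $\mathcal{F}$ is a compact subset of $\mathbb{K}_\alpha$. (ii) $\mathcal{F}$ is the closure of its interior. (iii) The boundary of $\mathcal{F}$ has measure zero: $\mu_\alpha(\partial\mathcal{F})=0$. (iv) The collection $\{\mathcal{F}+\Phi_\alpha(x):x\in\mathbb{Z}[\alpha]\}$ is a multiple tiling of $\mathbb{K}_\alpha$: its members are compact, and there is a positive integer $m$ such that $\mu_\alpha$-almost every point of $\mathbb{K}_\alpha$ lies in exactly $m$ members of the collection. -/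

import Mathlib

open MeasureTheory IsDedekindDomain NumberField
open scoped NumberField Pointwise IntermediateField

noncomputable section

namespace RationalTile

variable {K : Type*} [Field K]

/-! ### Expanding algebraic numbers and standard digit sets -/

/-- An algebraic number is expanding if every complex root of its minimal polynomial lies outside
the closed unit disc. (The minimal polynomial over `ℚ` and the primitive minimal polynomial in
`ℤ[X]` have the same roots.) -/
def IsExpanding [CharZero K] (α : K) : Prop :=
  ∀ z : ℂ, Polynomial.aeval z (minpoly ℚ α) = 0 → 1 < ‖z‖

/-- The subring `ℤ[α]` of `K`. -/
abbrev ZAdjoin (α : K) : Subalgebra ℤ K := Algebra.adjoin ℤ {α}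

/-- `D` is a complete set of coset representatives of the group `ℤ[α] / α ℤ[α]`. -/
def IsStandardDigitSet (α : K) (D : Set K) : Prop :=
  D ⊆ (ZAdjoin α : Set K) ∧
    ∀ x ∈ ZAdjoin α, ∃! d, d ∈ D ∧ ∃ y ∈ ZAdjoin α, x - d = α * y

variable [NumberField K]

/-! ### The denominator ideal of `α` -/

/-- The ideal `𝔟` in the representation `α 𝓞 = 𝔞 / 𝔟` with coprime integral ideals `𝔞`, `𝔟`:
it consists of all `x ∈ 𝓞` with `x α ∈ 𝓞`. -/
def denIdeal (α : K) : Ideal (𝓞 K) where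
  carrier := {x | ∃ y : 𝓞 K, (x : K) * α = y}
  zero_mem' := ⟨0, by simp⟩
  add_mem' := by
    rintro a b ⟨y, hy⟩ ⟨z, hz⟩
    exact ⟨y + z, by push_cast; rw [add_mul, hy, hz]⟩
  smul_mem' := by
    rintro c x ⟨y, hy⟩
    exact ⟨c * y, by rw [smul_eq_mul]; push_cast; rw [mul_assoc, hy]⟩

theorem denIdeal_ne_bot (α : K) : denIdeal α ≠ ⊥ := by
  obtain ⟨y, s, hs, h⟩ := IsFractionRing.div_surjective (A := 𝓞 K) α
  have hs0 : (s : K) ≠ 0 := by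
    simpa using nonZeroDivisors.ne_zero hs
  intro hb
  have hm : s ∈ denIdeal α := ⟨y, by rw [← h]; field_simp⟩
  rw [hb, Ideal.mem_bot] at hm
  exact hs0 (by simp [hm])

/-- `denIdeal α` is the denominator of the fractional ideal `α 𝓞` in lowest terms, and it is the
only ideal with this property. -/
theorem denIdeal_spec (α : K) (𝔟 : Ideal (𝓞 K)) :
    (∃ 𝔞 : Ideal (𝓞 K), IsCoprime 𝔞 𝔟 ∧ 𝔟 ≠ ⊥ ∧
      FractionalIdeal.spanSingleton (nonZeroDivisors (𝓞 K)) α =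
        (𝔞 : FractionalIdeal (nonZeroDivisors (𝓞 K)) K) / 𝔟) ↔ 𝔟 = denIdeal α := by
  have hI : (1 + FractionalIdeal.spanSingleton (nonZeroDivisors (𝓞 K)) α :
      FractionalIdeal (nonZeroDivisors (𝓞 K)) K) ≠ 0 := by
    intro h
    have h1 : (1 : K) ∈ (1 + FractionalIdeal.spanSingleton (nonZeroDivisors (𝓞 K)) α :
        FractionalIdeal (nonZeroDivisors (𝓞 K)) K) := by
      rw [← FractionalIdeal.sup_eq_add]
      exact (le_sup_left : _ ≤ (1 : FractionalIdeal (nonZeroDivisors (𝓞 K)) K) ⊔ _)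
        (FractionalIdeal.one_mem_one _)
    rw [h, FractionalIdeal.mem_zero_iff] at h1
    exact one_ne_zero h1
  have hden : (denIdeal α : FractionalIdeal (nonZeroDivisors (𝓞 K)) K) =
      (1 + FractionalIdeal.spanSingleton (nonZeroDivisors (𝓞 K)) α)⁻¹ := by
    ext x
    rw [FractionalIdeal.mem_inv_iff hI, FractionalIdeal.mem_coeIdeal]
    constructor
    · rintro ⟨x, ⟨y, hy⟩, rfl⟩ z hz
      rw [← FractionalIdeal.sup_eq_add] at hz
      obtain ⟨a, ha, b, hb, rfl⟩ := Submodule.mem_sup.1 hz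
      obtain ⟨a, rfl⟩ := (FractionalIdeal.mem_one_iff _).1 ha
      obtain ⟨b, rfl⟩ := (FractionalIdeal.mem_spanSingleton _).1 hb
      refine (FractionalIdeal.mem_one_iff _).2 ⟨x * a + b * y, ?_⟩
      rw [Algebra.smul_def, map_add, map_mul, map_mul, mul_add]
      linear_combination -(algebraMap (𝓞 K) K b) * hy
    · intro h
      have h1 := h 1 (by
        rw [← FractionalIdeal.sup_eq_add]
        exact (le_sup_left : _ ≤ (1 : FractionalIdeal (nonZeroDivisors (𝓞 K)) K) ⊔ _)
          (FractionalIdeal.one_mem_one _))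
      have h2 := h α (by
        rw [← FractionalIdeal.sup_eq_add]
        exact (le_sup_right : _ ≤ (1 : FractionalIdeal (nonZeroDivisors (𝓞 K)) K) ⊔ _)
          (FractionalIdeal.mem_spanSingleton_self _ _))
      obtain ⟨a, ha⟩ := (FractionalIdeal.mem_one_iff _).1 h1
      obtain ⟨b, hb⟩ := (FractionalIdeal.mem_one_iff _).1 h2
      rw [mul_one] at ha
      subst ha
      exact ⟨a, ⟨b, hb.symm⟩, rfl⟩
  have key : ∀ 𝔟 : Ideal (𝓞 K), 𝔟 = denIdeal α ↔
      (𝔟 : FractionalIdeal (nonZeroDivisors (𝓞 K)) K) *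
        (1 + FractionalIdeal.spanSingleton (nonZeroDivisors (𝓞 K)) α) = 1 := by
    intro 𝔟
    rw [← FractionalIdeal.coeIdeal_inj (K := K), hden, mul_eq_one_iff_eq_inv₀ hI]
  have h0 : ∀ 𝔟 : Ideal (𝓞 K), 𝔟 ≠ ⊥ →
      (𝔟 : FractionalIdeal (nonZeroDivisors (𝓞 K)) K) ≠ 0 :=
    fun 𝔟 h => FractionalIdeal.coeIdeal_ne_zero.2 h
  constructor
  · rintro ⟨𝔞, hco, hb, h⟩
    rw [key, h, mul_add, mul_one, mul_div_cancel₀ _ (h0 _ hb), add_comm]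
    rw [← FractionalIdeal.coeIdeal_sup, Ideal.isCoprime_iff_sup_eq.1 hco]
    exact FractionalIdeal.coeIdeal_top _
  · rintro rfl
    have hb := denIdeal_ne_bot α
    have hk := (key _).1 rfl
    have hle : (denIdeal α : FractionalIdeal (nonZeroDivisors (𝓞 K)) K) *
        FractionalIdeal.spanSingleton (nonZeroDivisors (𝓞 K)) α ≤ 1 := by
      rw [← hk, mul_add, ← FractionalIdeal.sup_eq_add]
      exact le_sup_right
    obtain ⟨𝔞, ha⟩ := FractionalIdeal.le_one_iff_exists_coeIdeal.1 hle
    refine ⟨𝔞, ?_, hb, ?_⟩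
    · rw [Ideal.isCoprime_iff_sup_eq, ← FractionalIdeal.coeIdeal_inj (K := K),
        FractionalIdeal.coeIdeal_sup, ha]
      rw [mul_add, mul_one, add_comm] at hk
      rw [hk]
      exact (FractionalIdeal.coeIdeal_top _).symm
    · rw [ha, mul_div_cancel_left₀ _ (h0 _ hb)]

/-! ### The representation space -/

/-- The finite primes in `S_α`: those which divide the denominator of `α`. -/
abbrev FinPrimes (α : K) : Type _ :=
  {v : HeightOneSpectrum (𝓞 K) // v.asIdeal ∣ denIdeal α}

instance (α : K) : Fintype (FinPrimes α) :=
  @Fintype.ofFinite _ (Ideal.finite_factors (denIdeal_ne_bot α)).to_subtype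

/-- The space `𝕂_𝔟`, the product of the completions `K_𝔭` over the finite primes `𝔭 ∣ 𝔟`. -/
abbrev FinPart (α : K) : Type _ := (v : FinPrimes α) → v.1.adicCompletion K

/-- The representation space `𝕂_α = 𝕂_∞ × 𝕂_𝔟`; here `𝕂_∞ = ℝ ^ r × ℂ ^ s` is the product of the
completions at the infinite places (real ones first). -/
abbrev RepSpace (α : K) : Type _ := mixedEmbedding.mixedSpace K × FinPart α

/-- The canonical ring homomorphism `Φ_α : K → 𝕂_α`. -/
def Phi (α : K) : K →+* RepSpace α :=
  (mixedEmbedding K).prod (RingHom.pi fun v : FinPrimes α => algebraMap K (v.1.adicCompletion K))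

/-! ### The measure on the representation space -/

instance (v : HeightOneSpectrum (𝓞 K)) : MeasurableSpace (v.adicCompletion K) := borel _

instance (v : HeightOneSpectrum (𝓞 K)) : BorelSpace (v.adicCompletion K) := ⟨rfl⟩

theorem isCompact_adicCompletionIntegers (v : HeightOneSpectrum (𝓞 K)) :
    IsCompact (v.adicCompletionIntegers K : Set (v.adicCompletion K)) := by
  have hfin : Finite (𝓞 K ⧸ v.asIdeal) := v.asIdeal.finiteQuotientOfFreeOfNeBot v.ne_bot
  let f : 𝓞 K →+* IsLocalRing.ResidueField (v.adicCompletionIntegers K) :=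
    (IsLocalRing.residue _).comp (algebraMap (𝓞 K) (v.adicCompletionIntegers K))
  have hker : ∀ a ∈ v.asIdeal, f a = 0 := by
    intro a ha
    rw [RingHom.comp_apply, IsLocalRing.residue_eq_zero_iff]
    rw [IsLocalRing.mem_maximalIdeal, mem_nonunits_iff,
      HeightOneSpectrum.adicCompletionIntegers.isUnit_iff_valued_eq_one]
    refine ne_of_lt ?_
    rw [HeightOneSpectrum.algebraMap_adicCompletionIntegers_apply]
    rw [HeightOneSpectrum.valuedAdicCompletion_eq_valuation']
    exact (HeightOneSpectrum.valuation_lt_one_iff_mem v a).2 ha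
  have hsurj : Function.Surjective (Ideal.Quotient.lift v.asIdeal f hker) := by
    refine Ideal.Quotient.lift_surjective_of_surjective _ _ fun x => ?_
    obtain ⟨x, rfl⟩ := IsLocalRing.residue_surjective x
    obtain ⟨k, hk⟩ : ∃ k : K, Valued.v ((x : v.adicCompletion K) -
        algebraMap K (v.adicCompletion K) k) < 1 := by
      have hopen : IsOpen {y : v.adicCompletion K | Valued.v ((x : v.adicCompletion K) - y) < 1} :=
        by
          have h := (Valued.isOpen_ball (v.adicCompletion K) 1).preimage
            (continuous_const (y := (x : v.adicCompletion K)) |>.sub continuous_id)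
          simpa [Set.preimage] using h
      obtain ⟨k, hk⟩ := (HeightOneSpectrum.denseRange_algebraMap K v).exists_mem_open hopen
        ⟨x, by simp⟩
      exact ⟨k, hk⟩
    have hk1 : v.valuation K k ≤ 1 := by
      rw [← HeightOneSpectrum.valuedAdicCompletion_eq_valuation' v k]
      have := Valued.v.map_sub (x : v.adicCompletion K)
        ((x : v.adicCompletion K) - algebraMap K (v.adicCompletion K) k)
      rw [sub_sub_cancel] at this
      exact this.trans (max_le x.2 hk.le)
    obtain ⟨a, ha⟩ := HeightOneSpectrum.exists_valuation_sub_lt_of_integer v hk1 1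
    refine ⟨a, ?_⟩
    rw [RingHom.comp_apply, ← sub_eq_zero, ← map_sub, IsLocalRing.residue_eq_zero_iff,
      IsLocalRing.mem_maximalIdeal, mem_nonunits_iff,
      HeightOneSpectrum.adicCompletionIntegers.isUnit_iff_valued_eq_one]
    refine ne_of_lt ?_
    have h1 : Valued.v (algebraMap K (v.adicCompletion K) (algebraMap (𝓞 K) K a - k)) < 1 := by
      have := HeightOneSpectrum.valuedAdicCompletion_eq_valuation' v (algebraMap (𝓞 K) K a - k)
      exact this.trans_lt ha
    have h2 := Valued.v.map_sub (algebraMap K (v.adicCompletion K) (algebraMap (𝓞 K) K a - k))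
      ((x : v.adicCompletion K) - algebraMap K (v.adicCompletion K) k)
    rw [show algebraMap K (v.adicCompletion K) (algebraMap (𝓞 K) K a - k) -
        ((x : v.adicCompletion K) - algebraMap K (v.adicCompletion K) k) =
        algebraMap K (v.adicCompletion K) (algebraMap (𝓞 K) K a) - x by
      rw [map_sub]; ring] at h2
    exact h2.trans_lt (max_lt h1 hk)
  have : Finite (IsLocalRing.ResidueField (v.adicCompletionIntegers K)) :=
    Finite.of_surjective _ hsurj
  have hcl : IsClosed (v.adicCompletionIntegers K : Set (v.adicCompletion K)) :=
    Valued.isClosed_valuationSubring _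
  have hc : CompactSpace (Valued.integer (v.adicCompletion K)) :=
    Valued.integer.compactSpace_iff_completeSpace_and_isDiscreteValuationRing_and_finite_residueField.2
      ⟨hcl.completeSpace_coe,
        inferInstanceAs (IsDiscreteValuationRing (v.adicCompletionIntegers K)), this⟩
  exact isCompact_iff_compactSpace.2 hc

/-- The ring of integers of `K_𝔭`, as a compact set with non-empty interior. -/
def integersCompacts (v : HeightOneSpectrum (𝓞 K)) :
    TopologicalSpace.PositiveCompacts (v.adicCompletion K) where
  carrier := v.adicCompletionIntegers K
  isCompact' := isCompact_adicCompletionIntegers v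
  interior_nonempty' := by
    have h : IsOpen (v.adicCompletionIntegers K : Set (v.adicCompletion K)) :=
      Valued.isOpen_valuationSubring _
    rw [h.interior_eq]
    exact ⟨0, zero_mem _⟩

/-- The Haar measure on `K_𝔭` which gives measure `1` to the ring of integers, that is, measure
`𝔑(𝔭) ^ (-k)` to the cosets of `𝔭 ^ k`. -/
def finMeasure (v : HeightOneSpectrum (𝓞 K)) : Measure (v.adicCompletion K) :=
  Measure.addHaarMeasure (integersCompacts v)

open scoped Classical in
/-- The measure `μ_α` on `𝕂_α`: the product of the Lebesgue measures on the factors `ℝ` and `ℂ` and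
of the normalized Haar measures on the finite completions. -/
def repMeasure (α : K) : Measure (RepSpace α) :=
  (volume : Measure (mixedEmbedding.mixedSpace K)).prod
    (Measure.pi fun v : FinPrimes α => finMeasure v.1)

/-! ### Tiles and tilings -/

/-- The set equation `α · F = ⋃_{d ∈ D} (F + Φ_α(d))`. -/
def SetEquation (α : K) (D : Set K) (F : Set (RepSpace α)) : Prop :=
  (fun z => Phi α α * z) '' F = ⋃ d ∈ D, (fun z => z + Phi α d) '' F

/-- A rational self-affine tile is a non-empty compact solution of the set equation that has
positive measure. -/
def IsRationalSelfAffineTile (α : K) (D : Set K) (F : Set (RepSpace α)) : Prop :=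
  F.Nonempty ∧ IsCompact F ∧ SetEquation α D F ∧ 0 < repMeasure α F

/-- The set `F(α, D)` of all sums `∑_{k ≥ 1} Φ_α(d_k α ^ (-k))` with digits `d_k ∈ D`. -/
def tile (α : K) (D : Set K) : Set (RepSpace α) :=
  {z | ∃ d : ℕ → K, (∀ k, d k ∈ D) ∧ HasSum (fun k => Phi α (d k * (α ^ (k + 1))⁻¹)) z}

/-- A collection of compact sets is a multiple tiling if there is a positive integer `m` such that
almost every point lies in exactly `m` members of the collection. -/
def IsMultipleTiling {X : Type*} [TopologicalSpace X] [MeasurableSpace X] (μ : Measure X)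
    (C : Set (Set X)) : Prop :=
  (∀ T ∈ C, IsCompact T) ∧
    ∃ m : ℕ, 0 < m ∧ ∀ᵐ z ∂μ, {T ∈ C | z ∈ T}.encard = m

end RationalTile

end

noncomputable section

namespace RationalTile

section SelfAffine

open Metric Filter Topology

variable {X : Type*} [NormedCommRing X]

/-! The geometry needs only a proper normed commutative ring `X`, a unit `a` whose inverse `b` has
norm less than 1, a discrete cocompact subgroup `Λ` with `a Λ ⊆ Λ`, and a residue system `D` of `Λ`
modulo `a Λ`. Write `F` for the set of digit sums.

Since `b` contracts, `F` is a continuous image of the compact space of digit sequences and the only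
non-empty compact solution of the set equation. The union of the translates `F + x`, `x ∈ Λ`, is
stable under multiplication by `b`, because every lattice point is `d + a y`. It is dense by
cocompactness and closed by local finiteness, hence it is `X`, and Baire gives `F` an interior
point. Self-similarity carries that point near every point of `F`.

For the measure, `a ^ n F` is a union of `q ^ n` translates of `F`, where `q` is the number of
digits, while `a` scales Haar measure by some `κ`. A packing argument gives `q ≤ κ`, so these
translates overlap in null sets. A small copy of `F` inside the interior of `F` has its boundary in
such overlaps, so the boundary is null. The covering multiplicity is almost everywhere invariant
under `Λ` and under `b`, and is constant near a generic point. These motions bring almost every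
point there, so it is constant almost everywhere.

Arithmetic enters only in `isTileSystem`. With the sup norm on `𝕂_α`, `α⁻¹` is small at the infinite
places by expansion, and at the primes of `𝔟` because they divide the denominator. An element of
`ℤ[α]` of norm less than 1 is integral at every prime and small at every infinite place, hence zero.
Cocompactness combines approximation at the finite primes with the Minkowski lattice. -/

/-- Data for an integral self-affine tile in a normed ring: multiplication by `a` is expanding with
inverse `b`, it maps the lattice `Λ` into itself, and `D` is a complete residue system of `Λ`
modulo `a Λ`. -/
structure IsTileSystem (a b : X) (Λ : AddSubgroup X) (D : Set X) : Prop where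
  mul_eq_one : a * b = 1
  norm_lt_one : ‖b‖ < 1
  discrete : ∃ ε > 0, ∀ x ∈ Λ, ‖x‖ < ε → x = 0
  cocompact : ∃ R, ∀ z, ∃ x ∈ Λ, ‖z - x‖ ≤ R
  mul_mem : ∀ x ∈ Λ, a * x ∈ Λ
  digits_subset : D ⊆ Λ
  existsUnique_digit : ∀ x ∈ Λ, ∃! d, d ∈ D ∧ ∃ y ∈ Λ, x - d = a * y

/-- The set of all sums `∑_{k ≥ 1} b ^ k d_k` with digits `d_k ∈ D`. -/
def digitSums (b : X) (D : Set X) : Set X :=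
  {z | ∃ d : ℕ → X, (∀ k, d k ∈ D) ∧ HasSum (fun k => b ^ (k + 1) * d k) z}

/-- The integer parts with `n` digits, i.e., the sums `∑_{k < n} a ^ k d_k` with `d_k ∈ D`. -/
def integerParts (a : X) (D : Set X) : ℕ → Set X
  | 0 => {0}
  | n + 1 => (fun p : X × X => a * p.1 + p.2) '' (integerParts a D n ×ˢ D)

theorem mem_image_add_right_iff {F : Set X} {x z : X} : z ∈ (fun z => z + x) '' F ↔ z - x ∈ F := by
  simp [sub_eq_add_neg]

theorem encard_translates_add (Λ : AddSubgroup X) {F : Set X} {t : X} (ht : t ∈ Λ) (z : X) :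
    {x | x ∈ Λ ∧ z + t - x ∈ F}.encard =
      {x | x ∈ Λ ∧ z - x ∈ F}.encard := by
  rw [← (add_left_injective t).encard_image {x | x ∈ Λ ∧ z - x ∈ F}]
  congr 1
  ext x
  constructor
  · rintro ⟨hx, hzx⟩
    exact ⟨x - t, ⟨Λ.sub_mem hx ht, by rwa [sub_sub_eq_add_sub]⟩, sub_add_cancel _ _⟩
  · rintro ⟨y, ⟨hy, hzy⟩, rfl⟩
    exact ⟨Λ.add_mem hy ht, by simpa using hzy⟩

/-! ### Digit expansions, compactness and uniqueness -/

namespace IsTileSystem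

variable {a b : X} {Λ : AddSubgroup X} {D : Set X}

theorem mul_pow_eq_one (h : IsTileSystem a b Λ D) (n : ℕ) : a ^ n * b ^ n = 1 := by
  rw [← mul_pow, h.mul_eq_one, one_pow]

theorem mul_cancel_left (h : IsTileSystem a b Λ D) (x : X) : a * (b * x) = x := by
  rw [← mul_assoc, h.mul_eq_one, one_mul]

theorem mul_cancel_right (h : IsTileSystem a b Λ D) (x : X) : b * (a * x) = x := by
  rw [← mul_assoc, mul_comm b, h.mul_eq_one, one_mul]

theorem pow_cancel_left (h : IsTileSystem a b Λ D) (n : ℕ) (x : X) : a ^ n * (b ^ n * x) = x := by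
  rw [← mul_assoc, h.mul_pow_eq_one, one_mul]

theorem pow_cancel_right (h : IsTileSystem a b Λ D) (n : ℕ) (x : X) : b ^ n * (a ^ n * x) = x := by
  rw [← mul_assoc, mul_comm (b ^ n), h.mul_pow_eq_one, one_mul]

theorem norm_pow_mul_le (b : X) (n : ℕ) (x : X) : ‖b ^ n * x‖ ≤ ‖b‖ ^ n * ‖x‖ := by
  induction n with
  | zero => simp
  | succ n ih =>
    rw [pow_succ', pow_succ', mul_assoc, mul_assoc]
    exact (norm_mul_le _ _).trans (mul_le_mul_of_nonneg_left ih (norm_nonneg _))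

theorem exists_pow_mul_lt (h : IsTileSystem a b Λ D) (C : ℝ) {ε : ℝ} (hε : 0 < ε) :
    ∃ n, ‖b‖ ^ n * C < ε := by
  have ht : Tendsto (fun n => ‖b‖ ^ n * C) atTop (𝓝 (0 * C)) :=
    (tendsto_pow_atTop_nhds_zero_of_lt_one (norm_nonneg b) h.norm_lt_one).mul_const C
  rw [zero_mul] at ht
  exact (ht.eventually (gt_mem_nhds hε)).exists

theorem tendsto_pow_mul (h : IsTileSystem a b Λ D) {g : ℕ → X} {C : ℝ} (hg : ∀ n, ‖g n‖ ≤ C) :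
    Tendsto (fun n => b ^ n * g n) atTop (𝓝 0) := by
  have ht : Tendsto (fun n => ‖b‖ ^ n * C) atTop (𝓝 (0 * C)) :=
    (tendsto_pow_atTop_nhds_zero_of_lt_one (norm_nonneg b) h.norm_lt_one).mul_const C
  rw [zero_mul] at ht
  refine squeeze_zero_norm (fun n => (norm_pow_mul_le b n _).trans ?_) ht
  exact mul_le_mul_of_nonneg_left (hg n) (by positivity)

theorem digit_unique (h : IsTileSystem a b Λ D) {d d' y y' : X} (hd : d ∈ D) (hd' : d' ∈ D)
    (hy : y ∈ Λ) (hy' : y' ∈ Λ) (e : d + a * y = d' + a * y') : d = d' ∧ y = y' := by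
  have hx : d + a * y ∈ Λ := Λ.add_mem (h.digits_subset hd) (h.mul_mem y hy)
  have hdd : d = d' := (h.existsUnique_digit _ hx).unique ⟨hd, y, hy, by ring⟩
    ⟨hd', y', hy', by rw [e]; ring⟩
  refine ⟨hdd, ?_⟩
  rw [hdd] at e
  rw [← h.mul_cancel_right y, add_left_cancel e, h.mul_cancel_right]

theorem exists_digit (h : IsTileSystem a b Λ D) {x : X} (hx : x ∈ Λ) :
    ∃ d ∈ D, ∃ y ∈ Λ, x = d + a * y := by
  obtain ⟨d, ⟨hd, y, hy, e⟩, -⟩ := h.existsUnique_digit x hx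
  exact ⟨d, hd, y, hy, by rw [← e]; ring⟩

theorem digits_nonempty (h : IsTileSystem a b Λ D) : D.Nonempty :=
  let ⟨d, hd, _⟩ := h.exists_digit Λ.zero_mem
  ⟨d, hd⟩

theorem finite_lattice_inter [ProperSpace X] (h : IsTileSystem a b Λ D) (r : ℝ) :
    {x | x ∈ Λ ∧ ‖x‖ ≤ r}.Finite := by
  obtain ⟨ε, hε, hdisc⟩ := h.discrete
  obtain ⟨t, ht, hcov⟩ := Metric.totallyBounded_iff.1
    (isCompact_closedBall (0 : X) r).totallyBounded (ε / 2) (half_pos hε)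
  have hx : ∀ x, ‖x‖ ≤ r → ∃ y ∈ t, dist x y < ε / 2 := by
    intro x hx
    simpa using hcov (mem_closedBall_zero_iff.2 hx)
  choose! f hf hfd using hx
  refine Set.Finite.of_injOn (f := f) (fun x hx => hf x hx.2) ?_ ht
  intro x hx y hy hxy
  refine sub_eq_zero.1 (hdisc _ (Λ.sub_mem hx.1 hy.1) ?_)
  rw [← dist_eq_norm]
  have h1 := hfd x hx.2
  have h2 := hfd y hy.2
  rw [← hxy] at h2
  linarith [dist_triangle_right x y (f x)]

theorem countable_lattice [ProperSpace X] (h : IsTileSystem a b Λ D) :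
    (Λ : Set X).Countable := by
  refine (Set.countable_iUnion fun n : ℕ => (h.finite_lattice_inter n).countable).mono ?_
  intro x hx
  obtain ⟨n, hn⟩ := exists_nat_ge ‖x‖
  exact Set.mem_iUnion.2 ⟨n, hx, hn⟩

/-- Subtracting from `d` the vector `a * f d`, with `f d ∈ Λ` close to `b * d`, keeps its residue
class and makes it bounded. Distinct digits remain distinct, and a ball contains finitely many
lattice points. -/
theorem finite_digits [ProperSpace X] (h : IsTileSystem a b Λ D) : D.Finite := by
  obtain ⟨R, hR⟩ := h.cocompact
  choose f hf hfR using fun z => hR (b * z)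
  refine Set.Finite.of_injOn (f := fun d => d - a * f d) ?_ ?_
    (h.finite_lattice_inter (‖a‖ * R))
  · intro d hd
    refine ⟨Λ.sub_mem (h.digits_subset hd) (h.mul_mem _ (hf d)), ?_⟩
    have : d - a * f d = a * (b * d - f d) := by rw [mul_sub, h.mul_cancel_left]
    change ‖d - a * f d‖ ≤ _
    rw [this]
    exact (norm_mul_le _ _).trans (mul_le_mul_of_nonneg_left (hfR d) (norm_nonneg _))
  · intro d hd d' hd' e
    refine (h.digit_unique hd hd' (Λ.neg_mem (hf d)) (Λ.neg_mem (hf d')) ?_).1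
    simpa [sub_eq_add_neg] using e

theorem exists_norm_digit_le [ProperSpace X] (h : IsTileSystem a b Λ D) :
    ∃ M, ∀ d ∈ D, ‖d‖ ≤ M :=
  h.finite_digits.isBounded.exists_norm_le

theorem exists_summable_bound [ProperSpace X] (h : IsTileSystem a b Λ D) :
    ∃ u : ℕ → ℝ, Summable u ∧ ∀ k, ∀ d ∈ D, ‖b ^ (k + 1) * d‖ ≤ u k := by
  obtain ⟨M, hM⟩ := h.exists_norm_digit_le
  refine ⟨fun k => ‖b‖ ^ (k + 1) * M, ?_, fun k d hd => ?_⟩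
  · exact ((summable_nat_add_iff 1).2
      (summable_geometric_of_lt_one (norm_nonneg b) h.norm_lt_one)).mul_right M
  · exact (norm_pow_mul_le b _ d).trans (mul_le_mul_of_nonneg_left (hM d hd) (by positivity))

theorem summable_digits [ProperSpace X] (h : IsTileSystem a b Λ D) {d : ℕ → X}
    (hd : ∀ k, d k ∈ D) : Summable fun k => b ^ (k + 1) * d k :=
  let ⟨_, hu, hub⟩ := h.exists_summable_bound
  Summable.of_norm_bounded hu fun k => hub k _ (hd k)

theorem digitSums_nonempty [ProperSpace X] (h : IsTileSystem a b Λ D) :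
    (digitSums b D).Nonempty :=
  let ⟨d, hd⟩ := h.digits_nonempty
  ⟨_, fun _ => d, fun _ => hd, (h.summable_digits fun _ => hd).hasSum⟩

theorem isCompact_digitSums [ProperSpace X] (h : IsTileSystem a b Λ D) :
    IsCompact (digitSums b D) := by
  obtain ⟨u, hu, hub⟩ := h.exists_summable_bound
  have himage : digitSums b D =
      (fun d : ℕ → X => ∑' k, b ^ (k + 1) * d k) '' Set.univ.pi fun _ => D := by
    ext z
    constructor
    · rintro ⟨d, hd, hz⟩
      exact ⟨d, fun k _ => hd k, hz.tsum_eq⟩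
    · rintro ⟨d, hd, rfl⟩
      have hd' : ∀ k, d k ∈ D := fun k => hd k trivial
      exact ⟨d, hd', (h.summable_digits hd').hasSum⟩
  rw [himage]
  refine (isCompact_univ_pi fun _ => h.finite_digits.isCompact).image_of_continuousOn ?_
  refine continuousOn_tsum (fun k => ?_) hu fun k d hd => hub k _ (hd k trivial)
  exact ((continuous_apply k).const_mul _).continuousOn

theorem isClosed_digitSums [ProperSpace X] (h : IsTileSystem a b Λ D) :
    IsClosed (digitSums b D) := h.isCompact_digitSums.isClosed

theorem exists_norm_digitSums_le [ProperSpace X] (h : IsTileSystem a b Λ D) :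
    ∃ M, 0 ≤ M ∧ ∀ z ∈ digitSums b D, ‖z‖ ≤ M := by
  obtain ⟨M, hM⟩ := h.isCompact_digitSums.isBounded.exists_norm_le
  obtain ⟨z, hz⟩ := h.digitSums_nonempty
  exact ⟨M, (norm_nonneg z).trans (hM z hz), hM⟩

theorem mul_digitSums [ProperSpace X] (h : IsTileSystem a b Λ D) :
    (fun z => a * z) '' digitSums b D = ⋃ d ∈ D, (fun z => z + d) '' digitSums b D := by
  ext w
  simp only [Set.mem_iUnion, exists_prop]
  constructor
  · rintro ⟨z, ⟨d, hd, hz⟩, rfl⟩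
    refine ⟨d 0, hd 0, a * z - d 0, ⟨fun k => d (k + 1), fun k => hd _, ?_⟩, by simp⟩
    have h1 := ((hasSum_nat_add_iff' 1).2 hz).mul_left a
    have e1 : (fun k => b ^ (k + 1) * d (k + 1)) =
        fun k => a * (b ^ (k + 1 + 1) * d (k + 1)) := by
      funext k
      rw [pow_succ' b (k + 1), mul_assoc, h.mul_cancel_left]
    have e2 : a * z - d 0 = a * (z - ∑ i ∈ Finset.range 1, b ^ (i + 1) * d i) := by
      simp [mul_sub, h.mul_cancel_left]
    rw [e1, e2]
    exact h1
  · rintro ⟨e, he, z, ⟨d, hd, hz⟩, rfl⟩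
    refine ⟨b * (z + e), ⟨fun k => Nat.casesOn k e d, fun k => ?_, ?_⟩, h.mul_cancel_left _⟩
    · cases k with
      | zero => exact he
      | succ k => exact hd k
    · refine (hasSum_nat_add_iff' 1).1 ?_
      have e1 : (fun k => b ^ (k + 1 + 1) * d k) = fun k => b * (b ^ (k + 1) * d k) := by
        funext k
        rw [pow_succ' b (k + 1), mul_assoc]
      simpa [e1, mul_add] using hz.mul_left b

/-- Iterating the set equation backwards from a point of `G` produces its digits, with remainder `b
^ n` times a bounded vector. Conversely, a finite digit sum plus `b ^ n * g` stays in `G`, and `G`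
is closed. -/
theorem eq_digitSums [ProperSpace X] (h : IsTileSystem a b Λ D) {G : Set X} (hne : G.Nonempty)
    (hG : IsCompact G)
    (hset : (fun z => a * z) '' G = ⋃ d ∈ D, (fun z => z + d) '' G) : G = digitSums b D := by
  obtain ⟨C, hC⟩ := hG.isBounded.exists_norm_le
  have hstep : ∀ z ∈ G, ∃ d ∈ D, ∃ w ∈ G, z = b * (w + d) := by
    intro z hz
    have h1 : a * z ∈ ⋃ d ∈ D, (fun z => z + d) '' G := hset ▸ Set.mem_image_of_mem _ hz
    simp only [Set.mem_iUnion, exists_prop] at h1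
    obtain ⟨d, hd, w, hw, e⟩ := h1
    exact ⟨d, hd, w, hw, by simp only at e; rw [e, h.mul_cancel_right]⟩
  have hback : ∀ d ∈ D, ∀ w ∈ G, b * (w + d) ∈ G := by
    intro d hd w hw
    have h1 : w + d ∈ (fun z => a * z) '' G := by
      rw [hset]
      exact Set.mem_biUnion hd (Set.mem_image_of_mem _ hw)
    obtain ⟨z, hz, e⟩ := h1
    rw [← e]
    simpa only [h.mul_cancel_right] using hz
  apply Set.Subset.antisymm
  · intro z hz
    choose! d hd w hw hdw using hstep
    have hwn : ∀ n, w^[n] z ∈ G := fun n => by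
      induction n with
      | zero => exact hz
      | succ n ih => rw [Function.iterate_succ_apply']; exact hw _ ih
    refine ⟨fun k => d (w^[k] z), fun k => hd _ (hwn k), ?_⟩
    have hsum : ∀ n, ∑ k ∈ Finset.range n, b ^ (k + 1) * d (w^[k] z) = z - b ^ n * w^[n] z := by
      intro n
      induction n with
      | zero => simp
      | succ n ih =>
        rw [Finset.sum_range_succ, ih, Function.iterate_succ_apply']
        nth_rewrite 1 [hdw _ (hwn n)]
        ring
    rw [(h.summable_digits fun k => hd _ (hwn k)).hasSum_iff_tendsto_nat]
    simp_rw [hsum]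
    simpa using (h.tendsto_pow_mul fun n => hC _ (hwn n)).const_sub z
  · rintro z ⟨d, hd, hz⟩
    obtain ⟨g, hg⟩ := hne
    have hmem : ∀ n, ∀ d : ℕ → X, (∀ k, d k ∈ D) →
        ∑ k ∈ Finset.range n, b ^ (k + 1) * d k + b ^ n * g ∈ G := by
      intro n
      induction n with
      | zero => intro d hd; simpa using hg
      | succ n ih =>
        intro d hd
        have h1 := hback _ (hd 0) _ (ih (fun k => d (k + 1)) fun k => hd _)
        convert h1 using 1
        rw [Finset.sum_range_succ']
        simp only [mul_add, Finset.mul_sum]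
        rw [Finset.sum_congr rfl fun k _ => show b ^ (k + 1 + 1) * d (k + 1) =
          b * (b ^ (k + 1) * d (k + 1)) by ring]
        ring
    refine hG.isClosed.mem_of_tendsto (b := atTop) ?_ (Eventually.of_forall fun n => hmem n d hd)
    simpa using hz.tendsto_sum_nat.add (h.tendsto_pow_mul fun _ => (le_refl ‖g‖))

/-! ### Integer parts -/

theorem integerParts_subset (h : IsTileSystem a b Λ D) (n : ℕ) : integerParts a D n ⊆ Λ := by
  induction n with
  | zero => simp [integerParts, Λ.zero_mem]
  | succ n ih =>
    rintro _ ⟨⟨e, d⟩, ⟨he, hd⟩, rfl⟩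
    exact Λ.add_mem (h.mul_mem _ (ih he)) (h.digits_subset hd)

theorem finite_integerParts [ProperSpace X] (h : IsTileSystem a b Λ D) (n : ℕ) :
    (integerParts a D n).Finite := by
  induction n with
  | zero => exact Set.finite_singleton _
  | succ n ih => exact (ih.prod h.finite_digits).image _

theorem ncard_integerParts (h : IsTileSystem a b Λ D) (n : ℕ) :
    (integerParts a D n).ncard = D.ncard ^ n := by
  induction n with
  | zero => simp [integerParts]
  | succ n ih =>
    rw [integerParts, Set.InjOn.ncard_image, Set.ncard_prod, ih, pow_succ]
    rintro ⟨e, d⟩ ⟨he, hd⟩ ⟨e', d'⟩ ⟨he', hd'⟩ heq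
    have := h.digit_unique hd hd' (h.integerParts_subset n he) (h.integerParts_subset n he')
      (by simpa [add_comm] using heq)
    exact Prod.ext this.2 this.1

theorem pow_mul_digitSums [ProperSpace X] (h : IsTileSystem a b Λ D) (n : ℕ) :
    (fun z => a ^ n * z) '' digitSums b D =
      ⋃ e ∈ integerParts a D n, (fun z => z + e) '' digitSums b D := by
  induction n with
  | zero => simp [integerParts]
  | succ n ih =>
    have h1 : (fun z => a ^ (n + 1) * z) '' digitSums b D =
        (fun z => a * z) '' ((fun z => a ^ n * z) '' digitSums b D) := by
      rw [Set.image_image]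
      simp only [pow_succ', mul_assoc]
    rw [h1, ih]
    ext w
    simp only [integerParts, Set.image_iUnion, Set.mem_iUnion, exists_prop]
    constructor
    · rintro ⟨e, he, _, ⟨z, hz, rfl⟩, rfl⟩
      have h2 : a * z ∈ ⋃ d ∈ D, (fun z => z + d) '' digitSums b D :=
        h.mul_digitSums ▸ Set.mem_image_of_mem _ hz
      simp only [Set.mem_iUnion, exists_prop] at h2
      obtain ⟨d, hd, y, hy, hyd⟩ := h2
      refine ⟨a * e + d, ⟨(e, d), ⟨he, hd⟩, rfl⟩, y, hy, ?_⟩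
      simp only at hyd ⊢
      rw [mul_add, ← hyd]
      ring
    · rintro ⟨_, ⟨⟨e, d⟩, ⟨he, hd⟩, rfl⟩, y, hy, rfl⟩
      have h2 : y + d ∈ (fun z => a * z) '' digitSums b D := by
        rw [h.mul_digitSums]
        exact Set.mem_biUnion hd (Set.mem_image_of_mem _ hy)
      obtain ⟨z, hz, hzd⟩ := h2
      refine ⟨e, he, z + e, ⟨z, hz, rfl⟩, ?_⟩
      simp only at hzd ⊢
      rw [mul_add, hzd]
      ring

theorem exists_eq_pow_mul_add [ProperSpace X] (h : IsTileSystem a b Λ D) (n : ℕ) {z : X}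
    (hz : z ∈ digitSums b D) :
    ∃ w ∈ digitSums b D, ∃ e ∈ integerParts a D n, a ^ n * z = w + e := by
  have h2 : a ^ n * z ∈ ⋃ e ∈ integerParts a D n, (fun z => z + e) '' digitSums b D :=
    h.pow_mul_digitSums n ▸ Set.mem_image_of_mem _ hz
  simp only [Set.mem_iUnion, exists_prop] at h2
  obtain ⟨e, he, w, hw, hwe⟩ := h2
  exact ⟨w, hw, e, he, hwe.symm⟩

theorem pow_mul_add_mem [ProperSpace X] (h : IsTileSystem a b Λ D) {n : ℕ} {w e : X}
    (hw : w ∈ digitSums b D) (he : e ∈ integerParts a D n) :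
    b ^ n * (w + e) ∈ digitSums b D := by
  have h2 : w + e ∈ (fun z => a ^ n * z) '' digitSums b D := by
    rw [h.pow_mul_digitSums]
    exact Set.mem_biUnion he (Set.mem_image_of_mem _ hw)
  obtain ⟨z, hz, hzd⟩ := h2
  rw [← hzd]
  simpa only [h.pow_cancel_right] using hz

/-! ### Covering by translates and interior points -/

theorem finite_translates_meeting_ball [ProperSpace X] (h : IsTileSystem a b Λ D) (r : ℝ) :
    {x | x ∈ Λ ∧ ∃ z, ‖z‖ ≤ r ∧ z - x ∈ digitSums b D}.Finite := by
  obtain ⟨M, -, hM⟩ := h.exists_norm_digitSums_le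
  refine (h.finite_lattice_inter (r + M)).subset ?_
  rintro x ⟨hx, z, hz, hzx⟩
  refine ⟨hx, ?_⟩
  have : x = z - (z - x) := by ring
  rw [this]
  exact (norm_sub_le _ _).trans (add_le_add hz (hM _ hzx))

/-- The covered set is stable under multiplication by `b`. Points of `f + Λ` are covered and come
within a bounded distance of `a ^ n * z`, so their images under `b ^ n` approach `z`. -/
theorem exists_sub_mem_digitSums [ProperSpace X] (h : IsTileSystem a b Λ D) (z : X) :
    ∃ x ∈ Λ, z - x ∈ digitSums b D := by
  set S : Set X := {z | ∃ x ∈ Λ, z - x ∈ digitSums b D}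
  have hdiv : ∀ z, a * z ∈ S → z ∈ S := by
    rintro z ⟨x, hx, hzx⟩
    obtain ⟨d, hd, y, hy, rfl⟩ := h.exists_digit hx
    refine ⟨y, hy, ?_⟩
    have h1 : b ^ 1 * (a * z - (d + a * y) + d) ∈ digitSums b D :=
      h.pow_mul_add_mem (n := 1) hzx ⟨(0, d), ⟨rfl, hd⟩, by simp⟩
    have h2 : a * z - (d + a * y) + d = a * (z - y) := by ring
    rwa [h2, pow_one, h.mul_cancel_right] at h1
  have hdivn : ∀ n z, a ^ n * z ∈ S → z ∈ S := by
    intro n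
    induction n with
    | zero => simp
    | succ n ih =>
      intro z hz
      rw [pow_succ', mul_assoc] at hz
      exact ih z (hdiv _ hz)
  obtain ⟨R, hR⟩ := h.cocompact
  obtain ⟨f, hf⟩ := h.digitSums_nonempty
  have hdense : ∀ ε > 0, ∃ s ∈ S, dist z s < ε := by
    intro ε hε
    obtain ⟨n, hn⟩ := h.exists_pow_mul_lt R hε
    obtain ⟨x, hx, hxR⟩ := hR (a ^ n * z - f)
    refine ⟨b ^ n * (f + x), hdivn n _ ⟨x, hx, ?_⟩, ?_⟩
    · rwa [h.pow_cancel_left, add_sub_cancel_right]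
    · rw [dist_eq_norm]
      have : z - b ^ n * (f + x) = b ^ n * (a ^ n * z - f - x) := by
        nth_rewrite 1 [← h.pow_cancel_right n z]
        ring
      rw [this]
      exact ((norm_pow_mul_le b n _).trans
        (mul_le_mul_of_nonneg_left hxR (by positivity))).trans_lt hn
  -- Density is not enough: a limit of covered points is covered because only finitely many
  -- translates meet the ball of radius `‖z‖ + 1`, which contains all approximants within distance 1
  -- of `z`.
  have hclosed : IsClosed (⋃ x ∈ {x | x ∈ Λ ∧ ∃ w, ‖w‖ ≤ ‖z‖ + 1 ∧ w - x ∈ digitSums b D},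
      (fun z => z + x) '' digitSums b D) :=
    (h.finite_translates_meeting_ball _).isClosed_biUnion fun x _ =>
      (Homeomorph.addRight x).isClosedMap _ h.isClosed_digitSums
  have hz := hclosed.closure_subset (a := z) (Metric.mem_closure_iff.2 fun ε hε => ?_)
  · simp only [Set.mem_iUnion, exists_prop, mem_image_add_right_iff] at hz
    obtain ⟨x, hx, hzx⟩ := hz
    exact ⟨x, hx.1, hzx⟩
  · obtain ⟨s, ⟨x, hx, hsx⟩, hs⟩ := hdense (min ε 1) (lt_min hε one_pos)
    refine ⟨s, Set.mem_biUnion ⟨hx, s, ?_, hsx⟩ (mem_image_add_right_iff.2 hsx),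
      hs.trans_le (min_le_left _ _)⟩
    have h1 : dist z s < 1 := hs.trans_le (min_le_right _ _)
    rw [dist_comm, dist_eq_norm] at h1
    linarith [norm_sub_norm_le s z]

/-- Baire's theorem for the countable closed cover by lattice translates. -/
theorem interior_digitSums_nonempty [ProperSpace X] (h : IsTileSystem a b Λ D) :
    (interior (digitSums b D)).Nonempty := by
  have : Countable Λ := h.countable_lattice.to_subtype
  obtain ⟨x, z, hz⟩ := nonempty_interior_of_iUnion_of_closed
    (f := fun x : Λ => Homeomorph.addRight (x : X) '' digitSums b D)
    (fun x => (Homeomorph.addRight (x : X)).isClosedMap _ h.isClosed_digitSums) (by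
      refine Set.eq_univ_of_forall fun z => ?_
      obtain ⟨x, hx, hzx⟩ := h.exists_sub_mem_digitSums z
      exact Set.mem_iUnion.2 ⟨⟨x, hx⟩, mem_image_add_right_iff.2 hzx⟩)
  rw [← Homeomorph.image_interior] at hz
  obtain ⟨w, hw, -⟩ := hz
  exact ⟨w, hw⟩

/-- Write a point as `b ^ n * (v + e)` and replace `v` by a fixed interior point `w`. The result is
again interior, and the error is `b ^ n * (v - w)`. -/
theorem closure_interior_digitSums [ProperSpace X] (h : IsTileSystem a b Λ D) :
    digitSums b D = closure (interior (digitSums b D)) := by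
  refine Set.Subset.antisymm (fun z hz => ?_)
    (closure_minimal interior_subset h.isClosed_digitSums)
  obtain ⟨w, hw⟩ := h.interior_digitSums_nonempty
  obtain ⟨M, -, hM⟩ := h.exists_norm_digitSums_le
  refine Metric.mem_closure_iff.2 fun ε hε => ?_
  obtain ⟨n, hn⟩ := h.exists_pow_mul_lt (M + M) hε
  obtain ⟨v, hv, e, he, hve⟩ := h.exists_eq_pow_mul_add n hz
  refine ⟨b ^ n * (w + e), ?_, ?_⟩
  · refine mem_interior.2 ⟨(fun y => a ^ n * y - e) ⁻¹' interior (digitSums b D), ?_, ?_, ?_⟩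
    · intro y hy
      have := h.pow_mul_add_mem (interior_subset hy) he
      rwa [sub_add_cancel, h.pow_cancel_right] at this
    · exact isOpen_interior.preimage (by fun_prop)
    · simpa [h.pow_cancel_left] using hw
  · rw [dist_eq_norm]
    have : z - b ^ n * (w + e) = b ^ n * (v - w) := by
      nth_rewrite 1 [← h.pow_cancel_right n z]
      rw [hve]
      ring
    rw [this]
    refine ((norm_pow_mul_le b n _).trans (mul_le_mul_of_nonneg_left ?_ (by positivity))).trans_lt hn
    exact (norm_sub_le _ _).trans (add_le_add (hM v hv) (hM w (interior_subset hw)))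

/-! ### Lattice translates of the set of digit sums -/

theorem finite_translates_containing [ProperSpace X] (h : IsTileSystem a b Λ D) (z : X) :
    {x | x ∈ Λ ∧ z - x ∈ digitSums b D}.Finite :=
  (h.finite_translates_meeting_ball ‖z‖).subset fun _ hx => ⟨hx.1, z, le_rfl, hx.2⟩

/-- Needed because a multiple tiling counts sets, not translation vectors. If two translates
coincide, the tile is invariant under their difference, whose multiples are then bounded lattice
points. Two of them agree, so the difference is torsion. -/
theorem translate_injOn [ProperSpace X] (h : IsTileSystem a b Λ D)
    (htf : ∀ x ∈ Λ, ∀ n : ℕ, n ≠ 0 → n • x = 0 → x = 0) :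
    Set.InjOn (fun x => (fun z => z + x) '' digitSums b D) Λ := by
  intro x hx x' hx' heq
  by_contra hne
  obtain ⟨f, hf⟩ := h.digitSums_nonempty
  obtain ⟨M, -, hM⟩ := h.exists_norm_digitSums_le
  have hstep : ∀ z ∈ digitSums b D, z + (x - x') ∈ digitSums b D := by
    intro z hz
    have h1 : z + x ∈ (fun z => z + x') '' digitSums b D := by
      rw [← show (fun z => z + x) '' digitSums b D = (fun z => z + x') '' digitSums b D from heq]
      exact Set.mem_image_of_mem _ hz
    rw [mem_image_add_right_iff] at h1
    rwa [← add_sub_assoc]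
  have hmem : ∀ n : ℕ, f + n • (x - x') ∈ digitSums b D := by
    intro n
    induction n with
    | zero => simpa using hf
    | succ n ih =>
      rw [succ_nsmul, ← add_assoc]
      exact hstep _ ih
  have hmaps : Set.MapsTo (fun n : ℕ => n • (x - x')) Set.univ {x | x ∈ Λ ∧ ‖x‖ ≤ M + M} := by
    intro n _
    refine ⟨Λ.nsmul_mem (Λ.sub_mem hx hx') n, ?_⟩
    have h1 : n • (x - x') = f + n • (x - x') - f := by ring
    change ‖n • (x - x')‖ ≤ _
    rw [h1]
    exact (norm_sub_le _ _).trans (add_le_add (hM _ (hmem n)) (hM f hf))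
  obtain ⟨i, -, j, -, hij, he⟩ :=
    Set.infinite_univ.exists_lt_map_eq_of_mapsTo hmaps (h.finite_lattice_inter _)
  refine hne (sub_eq_zero.1 (htf _ (Λ.sub_mem hx hx') (j - i) (by lia) ?_))
  rw [sub_nsmul _ hij.le]
  rw [show j • (x - x') = i • (x - x') from he.symm, add_neg_cancel]

end IsTileSystem

end SelfAffine

end RationalTile

end

/-! ### Haar measure: scaling, null overlaps and multiplicity -/

noncomputable section

namespace RationalTile

section SelfAffine

open Metric Filter Topology
open scoped ENNReal

/-- If the measure of a finite union is the sum of the measures, then the sets are pairwise almost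
disjoint. -/
theorem measure_inter_eq_zero_of_sum_le {X ι : Type*} [MeasurableSpace X] {μ : Measure X}
    {s : Finset ι} {A : ι → Set X} (hA : ∀ i ∈ s, MeasurableSet (A i))
    (hfin : ∀ i ∈ s, μ (A i) ≠ ∞) (hle : ∑ i ∈ s, μ (A i) ≤ μ (⋃ i ∈ s, A i))
    {i j : ι} (hi : i ∈ s) (hj : j ∈ s) (hij : i ≠ j) : μ (A i ∩ A j) = 0 := by
  classical
  have hj' : j ∈ s.erase i := Finset.mem_erase.2 ⟨hij.symm, hj⟩
  have hsum : ∑ k ∈ s, μ (A k) = μ (A i) + (μ (A j) + ∑ k ∈ (s.erase i).erase j, μ (A k)) := by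
    rw [Finset.add_sum_erase _ (fun k => μ (A k)) hj', Finset.add_sum_erase _ (fun k => μ (A k)) hi]
  have hunion : (⋃ k ∈ s, A k) = (A i ∪ A j) ∪ ⋃ k ∈ (s.erase i).erase j, A k := by
    rw [← Finset.insert_erase hi, ← Finset.insert_erase hj', Finset.set_biUnion_insert,
      Finset.set_biUnion_insert, Set.union_assoc]
    simp [hij, hij.symm]
  have h1 : μ (⋃ k ∈ s, A k) ≤ μ (A i ∪ A j) + ∑ k ∈ (s.erase i).erase j, μ (A k) := by
    rw [hunion]
    exact (measure_union_le _ _).trans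
      (add_le_add le_rfl (measure_biUnion_finset_le _ _))
  have h2 := measure_union_add_inter (μ := μ) (A i) (hA j hj)
  have hfin' : ∑ k ∈ s, μ (A k) ≠ ∞ := ENNReal.sum_ne_top.2 hfin
  have h3 : ∑ k ∈ s, μ (A k) + μ (A i ∩ A j) ≤ ∑ k ∈ s, μ (A k) + 0 := by
    calc ∑ k ∈ s, μ (A k) + μ (A i ∩ A j)
        ≤ (μ (A i ∪ A j) + ∑ k ∈ (s.erase i).erase j, μ (A k)) + μ (A i ∩ A j) :=
          add_le_add (hle.trans h1) le_rfl
      _ = (μ (A i ∪ A j) + μ (A i ∩ A j)) + ∑ k ∈ (s.erase i).erase j, μ (A k) := by ring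
      _ = ∑ k ∈ s, μ (A k) + 0 := by rw [h2, hsum, add_zero, add_assoc]
  exact le_antisymm ((ENNReal.add_le_add_iff_left hfin').1 h3) bot_le

namespace IsTileSystem

variable {X : Type*} [NormedCommRing X] [ProperSpace X] [MeasurableSpace X]
  {a b : X} {Λ : AddSubgroup X} {D : Set X}

theorem measure_digitSums_pos (μ : Measure X) [μ.IsAddHaarMeasure] (h : IsTileSystem a b Λ D) :
    0 < μ (digitSums b D) :=
  Measure.measure_pos_of_nonempty_interior _ h.interior_digitSums_nonempty

variable [BorelSpace X]

/-- Multiplication by `a` scales the Haar measure by a constant factor. -/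
theorem exists_measure_image_mul (μ : Measure X) [μ.IsAddHaarMeasure]
    (h : IsTileSystem a b Λ D) :
    ∃ κ : ℝ≥0∞, κ ≠ 0 ∧ κ ≠ ∞ ∧ ∀ n S, μ ((fun z => a ^ n * z) '' S) = κ ^ n * μ S := by
  let φ : X ≃ₜ+ X :=
    { toFun := fun z => a * z
      invFun := fun z => b * z
      left_inv := h.mul_cancel_right
      right_inv := h.mul_cancel_left
      map_add' := mul_add a
      continuous_toFun := by fun_prop
      continuous_invFun := by fun_prop }
  refine ⟨addEquivAddHaarChar φ, ?_, ENNReal.coe_ne_top, fun n => ?_⟩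
  · exact ENNReal.coe_ne_zero.2 (addEquivAddHaarChar_pos φ).ne'
  · induction n with
    | zero => simp
    | succ n ih =>
      intro S
      have h1 : (fun z => a ^ (n + 1) * z) '' S = φ '' ((fun z => a ^ n * z) '' S) := by
        rw [Set.image_image]
        exact Set.image_congr fun z _ => by rw [pow_succ', mul_assoc]; rfl
      rw [h1, ← addEquivAddHaarChar_smul_preimage μ φ,
        Set.preimage_image_eq _ φ.injective, ih, pow_succ', mul_assoc]
      rfl

/-- Multiplication by `a` scales the Haar measure by the number of digits, at least: this follows
by comparing the sums with `n` digits to a packing by small balls. -/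
theorem ncard_le_of_measure_image_mul (μ : Measure X) [μ.IsAddHaarMeasure]
    (h : IsTileSystem a b Λ D) {κ : ℝ≥0∞} (hκ : κ ≠ ∞)
    (hμ : ∀ n S, μ ((fun z => a ^ n * z) '' S) = κ ^ n * μ S) : (D.ncard : ℝ≥0∞) ≤ κ := by
  obtain ⟨ε, hε, hdisc⟩ := h.discrete
  obtain ⟨M, hM0, hM⟩ := h.exists_norm_digitSums_le
  obtain ⟨f, hf⟩ := h.digitSums_nonempty
  -- Dividing by `a ^ n` sends the ball of radius `ε / 2` around any `n`-digit integer part into the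
  -- closed ball of radius `C` about 0: `b ^ n * (f + e)` lies in the tile, and the rest is at most
  -- `ε / 2 + M`.
  set C := M + (ε / 2 + M)
  have hpack : ∀ n, (D.ncard : ℝ≥0∞) ^ n * μ (ball 0 (ε / 2)) ≤ κ ^ n * μ (closedBall 0 C) := by
    intro n
    have hE := h.finite_integerParts n
    have hdisj : (hE.toFinset : Set X).PairwiseDisjoint fun e => ball e (ε / 2) := by
      intro e he e' he' hne
      refine ball_disjoint_ball ?_
      rw [add_halves, dist_eq_norm]
      by_contra! hlt
      refine hne (sub_eq_zero.1 (hdisc _ (Λ.sub_mem ?_ ?_) hlt))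
      · exact h.integerParts_subset n (by simpa using he)
      · exact h.integerParts_subset n (by simpa using he')
    have hmeas := measure_biUnion_finset (μ := μ) hdisj fun e _ => measurableSet_ball
    have hball : ∀ e, μ (ball e (ε / 2)) = μ (ball 0 (ε / 2)) := fun e => by
      rw [← measure_preimage_add_right μ e, preimage_add_right_ball, sub_self]
    simp only [hball, Finset.sum_const, nsmul_eq_mul, ← Set.ncard_eq_toFinset_card _ hE,
      h.ncard_integerParts, Nat.cast_pow] at hmeas
    rw [← hmeas, ← hμ]
    refine measure_mono (Set.iUnion₂_subset fun e he z hz => ?_)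
    refine ⟨b ^ n * z, ?_, h.pow_cancel_left _ _⟩
    have he' : e ∈ integerParts a D n := by simpa using he
    have h1 := hM _ (h.pow_mul_add_mem hf he')
    have h2 : b ^ n * z = b ^ n * (f + e) + b ^ n * (z - e - f) := by ring
    have h3 : ‖z - e - f‖ ≤ ε / 2 + M :=
      (norm_sub_le _ _).trans (add_le_add (mem_ball_iff_norm.1 hz).le (hM f hf))
    have h4 : ‖b ^ n * (z - e - f)‖ ≤ ε / 2 + M := by
      refine (norm_pow_mul_le b n _).trans ((mul_le_of_le_one_left (norm_nonneg _) ?_).trans h3)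
      exact pow_le_one₀ (norm_nonneg b) h.norm_lt_one.le
    rw [mem_closedBall_zero_iff, h2]
    exact (norm_add_le _ _).trans (add_le_add h1 h4)
  -- If `κ` were less than the number of digits `q`, then `(κ / q) ^ n` would tend to 0, against the
  -- uniform packing bound.
  by_contra! hlt
  have hball0 : μ (ball (0 : X) (ε / 2)) ≠ 0 := (measure_ball_pos μ 0 (half_pos hε)).ne'
  have hballtop : μ (ball (0 : X) (ε / 2)) ≠ ∞ := measure_ball_lt_top.ne
  have hCtop : μ (closedBall (0 : X) C) ≠ ∞ := measure_closedBall_lt_top.ne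
  set q : ℝ := (D.ncard : ℝ)
  set k : ℝ := κ.toReal
  set β : ℝ := (μ (ball (0 : X) (ε / 2))).toReal
  set γ : ℝ := (μ (closedBall (0 : X) C)).toReal
  have hβ : 0 < β := ENNReal.toReal_pos hball0 hballtop
  have hk0 : 0 ≤ k := ENNReal.toReal_nonneg
  have hkq : k < q := by
    have := (ENNReal.toReal_lt_toReal hκ (ENNReal.natCast_ne_top _)).2 hlt
    simpa using this
  have hreal : ∀ n : ℕ, q ^ n * β ≤ k ^ n * γ := by
    intro n
    have := ENNReal.toReal_mono (ENNReal.mul_ne_top (ENNReal.pow_ne_top hκ) hCtop) (hpack n)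
    simpa using this
  have hq : 0 < q := hk0.trans_lt hkq
  have ht : Tendsto (fun n => (k / q) ^ n * γ) atTop (𝓝 (0 * γ)) :=
    (tendsto_pow_atTop_nhds_zero_of_lt_one (by positivity)
      ((div_lt_one hq).2 hkq)).mul_const γ
  rw [zero_mul] at ht
  obtain ⟨n, hn⟩ := (ht.eventually (gt_mem_nhds hβ)).exists
  have := hreal n
  rw [div_pow, div_mul_eq_mul_div, div_lt_iff₀ (by positivity)] at hn
  linarith

/-- Translates of the set of digit sums by distinct integer parts of the same length are almost
disjoint. -/
theorem measure_translate_inter_eq_zero (μ : Measure X) [μ.IsAddHaarMeasure]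
    (h : IsTileSystem a b Λ D) {n : ℕ} {e e' : X} (he : e ∈ integerParts a D n)
    (he' : e' ∈ integerParts a D n) (hne : e ≠ e') :
    μ ((fun z => z + e) '' digitSums b D ∩ (fun z => z + e') '' digitSums b D) = 0 := by
  obtain ⟨κ, -, hκtop, hκ⟩ := h.exists_measure_image_mul μ
  have hE := h.finite_integerParts n
  have htrans : ∀ e, μ ((fun z => z + e) '' digitSums b D) = μ (digitSums b D) := fun e => by
    rw [Set.image_add_right, measure_preimage_add_right]
  refine measure_inter_eq_zero_of_sum_le (s := hE.toFinset)
    (A := fun e => (fun z => z + e) '' digitSums b D) (fun e _ => ?_) (fun e _ => ?_) ?_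
    (by simpa using he) (by simpa using he') hne
  · exact ((Homeomorph.addRight e).isClosedMap _ h.isClosed_digitSums).measurableSet
  · rw [htrans]
    exact h.isCompact_digitSums.measure_ne_top
  · have hU : (⋃ e ∈ hE.toFinset, (fun z => z + e) '' digitSums b D) =
        (fun z => a ^ n * z) '' digitSums b D := by
      rw [h.pow_mul_digitSums]
      simp
    rw [hU, hκ]
    simp only [htrans, Finset.sum_const, nsmul_eq_mul, ← Set.ncard_eq_toFinset_card _ hE,
      h.ncard_integerParts, Nat.cast_pow]
    gcongr
    exact h.ncard_le_of_measure_image_mul μ hκtop hκ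

/-- For large `n`, some copy `b ^ n (F + e)` lies inside the interior of `F`. Magnified, `F + e`
lies in an open set covered by the translates with `n` digits, so each of its boundary points must
lie in another translate, and overlaps are null. -/
theorem measure_frontier_digitSums (μ : Measure X) [μ.IsAddHaarMeasure]
    (h : IsTileSystem a b Λ D) : μ (frontier (digitSums b D)) = 0 := by
  obtain ⟨w, hw⟩ := h.interior_digitSums_nonempty
  obtain ⟨M, -, hM⟩ := h.exists_norm_digitSums_le
  obtain ⟨r, hr, hball⟩ := Metric.isOpen_iff.1 isOpen_interior w hw
  obtain ⟨n, hn⟩ := h.exists_pow_mul_lt (M + M) hr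
  obtain ⟨v, hv, e, he, hve⟩ := h.exists_eq_pow_mul_add n (interior_subset hw)
  set O : Set X := (fun y => b ^ n * y) ⁻¹' interior (digitSums b D)
  have hOopen : IsOpen O := isOpen_interior.preimage (by fun_prop)
  have hOsub : O ⊆ ⋃ e ∈ integerParts a D n, (fun z => z + e) '' digitSums b D := by
    rw [← h.pow_mul_digitSums]
    exact fun y hy => ⟨_, interior_subset hy, h.pow_cancel_left _ _⟩
  have hFO : ∀ z ∈ digitSums b D, z + e ∈ O := by
    intro z hz
    refine hball ?_
    rw [mem_ball_iff_norm]
    have : b ^ n * (z + e) - w = b ^ n * (z - v) := by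
      nth_rewrite 1 [← h.pow_cancel_right n w]
      rw [hve]
      ring
    rw [this]
    refine ((norm_pow_mul_le b n _).trans (mul_le_mul_of_nonneg_left ?_ (by positivity))).trans_lt hn
    exact (norm_sub_le _ _).trans (add_le_add (hM z hz) (hM v hv))
  have hE := h.finite_integerParts n
  set T : Set X := ⋃ e' ∈ integerParts a D n \ {e}, (fun z => z + e') '' digitSums b D with hT
  have hTclosed : IsClosed T := hE.sdiff.isClosed_biUnion fun e' _ =>
    (Homeomorph.addRight e').isClosedMap _ h.isClosed_digitSums
  have hsub : frontier (digitSums b D) ⊆ (fun z => z + e) ⁻¹' (⋃ e' ∈ integerParts a D n \ {e},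
      ((fun z => z + e) '' digitSums b D ∩ (fun z => z + e') '' digitSums b D)) := by
    intro z hz
    have hzF : z ∈ digitSums b D := h.isClosed_digitSums.frontier_subset hz
    have hzT : z + e ∈ T := by
      by_contra hzT
      have hnhds : (fun z => z + e) ⁻¹' (O ∩ Tᶜ) ∈ 𝓝 z :=
        ((hOopen.inter hTclosed.isOpen_compl).preimage (by fun_prop)).mem_nhds ⟨hFO z hzF, hzT⟩
      refine hz.2 (mem_interior_iff_mem_nhds.2 (mem_of_superset hnhds ?_))
      rintro y ⟨hyO, hyT⟩
      have hy := hOsub hyO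
      simp only [Set.mem_iUnion, exists_prop] at hy
      obtain ⟨e', he', hye'⟩ := hy
      by_cases hee : e' = e
      · rw [hee, mem_image_add_right_iff] at hye'
        simpa using hye'
      · exact absurd (Set.mem_biUnion (show e' ∈ integerParts a D n \ {e} from ⟨he', hee⟩) hye') hyT
    simp only [hT, Set.mem_iUnion, exists_prop] at hzT
    obtain ⟨e', he', hze'⟩ := hzT
    exact Set.mem_biUnion (show e' ∈ integerParts a D n \ {e} from he')
      ⟨Set.mem_image_of_mem _ hzF, hze'⟩
  refine measure_mono_null hsub ?_
  rw [measure_preimage_add_right, measure_biUnion_null_iff hE.sdiff.countable]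
  exact fun e' he' => h.measure_translate_inter_eq_zero μ he he'.1 fun hee => he'.2 hee.symm

/-! ### Multiplicity of the covering by translates -/

theorem ae_translate (μ : Measure X) [μ.IsAddHaarMeasure] (h : IsTileSystem a b Λ D)
    {p : X → Prop} (hp : ∀ᵐ z ∂μ, p z) : ∀ᵐ z ∂μ, ∀ x ∈ Λ, p (z + x) := by
  refine (ae_ball_iff h.countable_lattice).2 fun x _ => ?_
  exact (measurePreserving_add_right μ x).quasiMeasurePreserving.ae hp

theorem ae_pow_mul (μ : Measure X) [μ.IsAddHaarMeasure] (h : IsTileSystem a b Λ D)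
    {p : X → Prop} (hp : ∀ᵐ z ∂μ, p z) : ∀ᵐ z ∂μ, ∀ n : ℕ, p (b ^ n * z) := by
  obtain ⟨κ, -, -, hκ⟩ := h.exists_measure_image_mul μ
  refine ae_all_iff.2 fun n => ?_
  rw [ae_iff] at hp ⊢
  have : {z | ¬p (b ^ n * z)} = (fun z => a ^ n * z) '' {z | ¬p z} := by
    ext z
    constructor
    · exact fun hz => ⟨_, hz, h.pow_cancel_left _ _⟩
    · rintro ⟨z, hz, rfl⟩
      simpa [h.pow_cancel_right] using hz
  rw [this, hκ, hp, mul_zero]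

/-- The map `d + a y ↦ y` sends translates containing `z` onto those containing `b * z`, by the set
equation. Two translates with the same image put `z - a * y` into both `F + d` and `F + d'`, which
happens only on a null set. -/
theorem ae_encard_translates_mul (μ : Measure X) [μ.IsAddHaarMeasure]
    (h : IsTileSystem a b Λ D) :
    ∀ᵐ z ∂μ, {x | x ∈ Λ ∧ b * z - x ∈ digitSums b D}.encard =
      {x | x ∈ Λ ∧ z - x ∈ digitSums b D}.encard := by
  have hdisj : ∀ᵐ z ∂μ, ∀ d ∈ D, ∀ d' ∈ D, d ≠ d' →
      ¬(z - d ∈ digitSums b D ∧ z - d' ∈ digitSums b D) := by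
    refine (ae_ball_iff h.finite_digits.countable).2 fun d hd =>
      (ae_ball_iff h.finite_digits.countable).2 fun d' hd' => ?_
    by_cases hne : d = d'
    · simp [hne]
    have h1 : ∀ d ∈ D, d ∈ integerParts a D 1 := fun d hd => ⟨(0, d), ⟨rfl, hd⟩, by simp⟩
    have h2 := h.measure_translate_inter_eq_zero μ (h1 d hd) (h1 d' hd') hne
    filter_upwards [measure_eq_zero_iff_ae_notMem.1 h2] with z hz _ hzz
    exact hz ⟨mem_image_add_right_iff.2 hzz.1, mem_image_add_right_iff.2 hzz.2⟩
  have hdigit : ∀ x ∈ Λ, ∃ d ∈ D, ∃ y ∈ Λ, x = d + a * y := fun x hx => h.exists_digit hx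
  choose! δ hδ y hy hx using hdigit
  filter_upwards [h.ae_translate μ hdisj] with z hz
  have hmap : ∀ x ∈ Λ, z - x ∈ digitSums b D → b * z - y x ∈ digitSums b D := by
    intro x hxΛ hzx
    have h1 := h.pow_mul_add_mem (n := 1) hzx 
      (show δ x ∈ integerParts a D 1 from ⟨(0, δ x), ⟨rfl, hδ x hxΛ⟩, by simp⟩)
    have h2 : z - x + δ x = z - a * y x := by
      nth_rewrite 1 [hx x hxΛ]
      ring
    rwa [h2, pow_one, mul_sub, h.mul_cancel_right] at h1
  suffices hbij : Set.BijOn y {x | x ∈ Λ ∧ z - x ∈ digitSums b D}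
      {x | x ∈ Λ ∧ b * z - x ∈ digitSums b D} by
    rw [← hbij.image_eq, hbij.injOn.encard_image]
  refine ⟨?_, ?_, ?_⟩
  · exact fun x hx => ⟨hy x hx.1, hmap x hx.1 hx.2⟩
  · rintro x ⟨hxΛ, hzx⟩ x' ⟨hxΛ', hzx'⟩ hyy
    by_contra hne
    have hδne : δ x ≠ δ x' := fun hδδ => hne (by rw [hx x hxΛ, hx x' hxΛ', hδδ, hyy])
    refine hz (-(a * y x)) (Λ.neg_mem (h.mul_mem _ (hy x hxΛ))) (δ x) (hδ x hxΛ) (δ x')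
      (hδ x' hxΛ') hδne ⟨?_, ?_⟩
    · rw [hx x hxΛ] at hzx
      convert hzx using 1
      ring
    · rw [hx x' hxΛ', ← hyy] at hzx'
      convert hzx' using 1
      ring
  · rintro t ⟨ht, hzt⟩
    obtain ⟨v, hv, e, he, hve⟩ := h.exists_eq_pow_mul_add 1 hzt
    obtain ⟨⟨_, d⟩, ⟨rfl, hd⟩, rfl⟩ := he
    have hdx : d + a * t ∈ Λ := Λ.add_mem (h.digits_subset hd) (h.mul_mem t ht)
    refine ⟨d + a * t, ⟨hdx, ?_⟩, ?_⟩
    · rw [pow_one, mul_sub, h.mul_cancel_left] at hve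
      have : z - (d + a * t) = v := by
        rw [← sub_sub, sub_right_comm, hve]
        ring
      rwa [this]
    · exact (h.digit_unique hd (hδ _ hdx) ht (hy _ hdx) (hx _ hdx)).2.symm

/-- Almost every point is covered by the same number of lattice translates. -/
theorem exists_ae_encard_translates (μ : Measure X) [μ.IsAddHaarMeasure]
    (h : IsTileSystem a b Λ D) :
    ∃ m : ℕ, 0 < m ∧ ∀ᵐ z ∂μ, {x | x ∈ Λ ∧ z - x ∈ digitSums b D}.encard = m := by
  obtain ⟨w, hw⟩ : ∃ w, ∀ x ∈ Λ, w + x ∉ frontier (digitSums b D) := by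
    have h1 := measure_eq_zero_iff_ae_notMem.1 (h.measure_frontier_digitSums μ)
    exact (h.ae_translate μ h1).exists
  have hfin := h.finite_translates_containing w
  refine ⟨{x | x ∈ Λ ∧ w - x ∈ digitSums b D}.ncard, ?_, ?_⟩
  · rw [Set.ncard_pos hfin]
    exact h.exists_sub_mem_digitSums w
  rw [hfin.cast_ncard_eq]
  -- No translate has `w` on its boundary and only finitely many come near `w`, so the list of
  -- translates containing a point is constant around `w`.
  have hlocal : ∀ᶠ y in 𝓝 w, {x | x ∈ Λ ∧ y - x ∈ digitSums b D} =
      {x | x ∈ Λ ∧ w - x ∈ digitSums b D} := by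
    have hT := h.finite_translates_meeting_ball (‖w‖ + 1)
    have h1 : ∀ᶠ y in 𝓝 w, ∀ x ∈ {x | x ∈ Λ ∧ ∃ z, ‖z‖ ≤ ‖w‖ + 1 ∧ z - x ∈ digitSums b D},
        (y - x ∈ digitSums b D ↔ w - x ∈ digitSums b D) := by
      refine (eventually_all_finite hT).2 fun x hx => ?_
      have hcont : Tendsto (fun y => y - x) (𝓝 w) (𝓝 (w - x)) := by
        exact (continuous_id.sub continuous_const).tendsto w
      by_cases hwx : w - x ∈ digitSums b D
      · have hint : w - x ∈ interior (digitSums b D) := by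
          by_contra hcon
          refine hw (-x) (Λ.neg_mem hx.1) ?_
          rw [← sub_eq_add_neg, h.isClosed_digitSums.frontier_eq]
          exact ⟨hwx, hcon⟩
        filter_upwards [hcont.eventually (isOpen_interior.mem_nhds hint)] with y hy
        exact ⟨fun _ => hwx, fun _ => interior_subset hy⟩
      · filter_upwards [hcont.eventually
          (h.isClosed_digitSums.isOpen_compl.mem_nhds hwx)] with y hy
        exact ⟨fun hyx => absurd hyx hy, fun hwx' => absurd hwx' hwx⟩
    filter_upwards [h1, ball_mem_nhds w one_pos] with y hy hyw
    have hyn : ‖y‖ ≤ ‖w‖ + 1 := by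
      have := mem_ball_iff_norm.1 hyw
      linarith [norm_sub_norm_le y w]
    ext x
    constructor
    · rintro ⟨hx, hyx⟩
      exact ⟨hx, (hy x ⟨hx, y, hyn, hyx⟩).1 hyx⟩
    · rintro ⟨hx, hwx⟩
      exact ⟨hx, (hy x ⟨hx, w, by linarith, hwx⟩).2 hwx⟩
  obtain ⟨r, hr, hball⟩ := Metric.eventually_nhds_iff_ball.1 hlocal
  obtain ⟨R, hR⟩ := h.cocompact
  obtain ⟨n, hn⟩ := h.exists_pow_mul_lt (R + R) hr
  filter_upwards [h.ae_translate μ (h.ae_pow_mul μ (h.ae_encard_translates_mul μ))] with z hz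
  -- Shifting `z` by `t - s` makes it `2R`-close to `a ^ n * w`; then `b ^ n` carries it into the
  -- ball around `w`. Neither motion changes the multiplicity.
  obtain ⟨s, hs, hsR⟩ := hR z
  obtain ⟨t, ht, htR⟩ := hR (a ^ n * w)
  have hiter : ∀ k, {x | x ∈ Λ ∧ b ^ k * (z + (t - s)) - x ∈ digitSums b D}.encard =
      {x | x ∈ Λ ∧ z - x ∈ digitSums b D}.encard := by
    intro k
    induction k with
    | zero => simpa using encard_translates_add Λ (Λ.sub_mem ht hs) z
    | succ k ih =>
      rw [← ih, ← hz (t - s) (Λ.sub_mem ht hs) k, pow_succ']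
      simp only [mul_assoc]
  rw [← hiter n, hball]
  rw [mem_ball_iff_norm]
  have : b ^ n * (z + (t - s)) - w = b ^ n * ((z - s) - (a ^ n * w - t)) := by
    nth_rewrite 1 [← h.pow_cancel_right n w]
    ring
  rw [this]
  refine ((norm_pow_mul_le b n _).trans (mul_le_mul_of_nonneg_left ?_ (by positivity))).trans_lt hn
  exact (norm_sub_le _ _).trans (add_le_add hsR htR)

theorem isMultipleTiling (μ : Measure X) [μ.IsAddHaarMeasure] (h : IsTileSystem a b Λ D)
    (htf : ∀ x ∈ Λ, ∀ n : ℕ, n ≠ 0 → n • x = 0 → x = 0) :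
    IsMultipleTiling μ {T | ∃ x ∈ Λ, T = (fun z => z + x) '' digitSums b D} := by
  refine ⟨?_, ?_⟩
  · rintro _ ⟨x, -, rfl⟩
    exact h.isCompact_digitSums.image (by fun_prop)
  · obtain ⟨m, hm, hae⟩ := h.exists_ae_encard_translates μ
    refine ⟨m, hm, ?_⟩
    filter_upwards [hae] with z hz
    rw [← hz, ← Set.InjOn.encard_image ((h.translate_injOn htf).mono fun x hx => hx.1)]
    congr 1
    ext T
    constructor
    · rintro ⟨⟨x, hx, rfl⟩, hz⟩
      exact ⟨x, ⟨hx, mem_image_add_right_iff.1 hz⟩, rfl⟩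
    · rintro ⟨x, ⟨hx, hzx⟩, rfl⟩
      exact ⟨⟨x, hx, rfl⟩, mem_image_add_right_iff.2 hzx⟩

end IsTileSystem

end SelfAffine

end RationalTile

end

/-! ### Arithmetic of `ℤ[α]` in the representation space -/

noncomputable section

namespace RationalTile

open HeightOneSpectrum

variable {K : Type*} [Field K] [NumberField K]

/-! ### Norms on the finite completions -/

theorem norm_algebraMap_adicCompletion (v : HeightOneSpectrum (𝓞 K)) (x : K) :
    ‖algebraMap K (v.adicCompletion K) x‖ =
      WithZeroMulInt.toNNReal (NumberField.HeightOneSpectrum.absNorm_ne_zero v)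
        (v.valuation K x) := by
  rw [FinitePlace.norm_def]
  congr 2
  exact valuedAdicCompletion_eq_valuation' v x

theorem norm_algebraMap_adicCompletion_le_one_iff (v : HeightOneSpectrum (𝓞 K)) (x : K) :
    ‖algebraMap K (v.adicCompletion K) x‖ ≤ 1 ↔ v.valuation K x ≤ 1 := by
  rw [norm_algebraMap_adicCompletion,
    ← WithZeroMulInt.toNNReal_le_one_iff (NumberField.HeightOneSpectrum.one_lt_absNorm_nnreal v)]
  norm_cast

theorem norm_algebraMap_adicCompletion_int_le_one (v : HeightOneSpectrum (𝓞 K)) (x : 𝓞 K) :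
    ‖algebraMap K (v.adicCompletion K) x‖ ≤ 1 :=
  (norm_algebraMap_adicCompletion_le_one_iff v _).2 (v.valuation_le_one x)

theorem mem_adicCompletionIntegers_iff_norm_le_one (v : HeightOneSpectrum (𝓞 K))
    (x : v.adicCompletion K) : x ∈ v.adicCompletionIntegers K ↔ ‖x‖ ≤ 1 := by
  rw [mem_adicCompletionIntegers, FinitePlace.norm_def,
    ← WithZeroMulInt.toNNReal_le_one_iff (NumberField.HeightOneSpectrum.one_lt_absNorm_nnreal v)]
  norm_cast

/-- For each `ε` there is a power of the prime ideal all of whose elements have norm less than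
`ε`. -/
theorem exists_norm_lt_of_valuation_le (v : HeightOneSpectrum (𝓞 K)) {ε : ℝ} (hε : 0 < ε) :
    ∃ e : ℕ, ∀ x : K, v.valuation K x ≤ WithZero.exp (-(e : ℤ)) →
      ‖algebraMap K (v.adicCompletion K) x‖ < ε := by
  have h1 := NumberField.HeightOneSpectrum.one_lt_absNorm_nnreal v
  have h0 := NumberField.HeightOneSpectrum.absNorm_ne_zero v
  set q : NNReal := (Ideal.absNorm v.asIdeal : NNReal)
  obtain ⟨e, he⟩ := exists_pow_lt_of_lt_one hε (NNReal.coe_lt_one.2 (inv_lt_one_of_one_lt₀ h1))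
  refine ⟨e, fun x hx => ?_⟩
  rw [norm_algebraMap_adicCompletion]
  have h2 := (WithZeroMulInt.toNNReal_strictMono h1).monotone hx
  have h3 : WithZeroMulInt.toNNReal h0 (WithZero.exp (-(e : ℤ))) = q⁻¹ ^ e := by
    rw [WithZeroMulInt.toNNReal_neg_apply _ WithZero.exp_ne_zero, inv_pow, ← zpow_natCast,
      ← zpow_neg]
    rfl
  rw [h3] at h2
  exact lt_of_le_of_lt (by exact_mod_cast h2) he

/-- The compact open ring of integers gives local compactness; a negative power of a uniformizer
gives an element of norm greater than 1. -/
instance (v : HeightOneSpectrum (𝓞 K)) : ProperSpace (v.adicCompletion K) := by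
  obtain ⟨e, he⟩ := exists_norm_lt_of_valuation_le (K := K) v one_pos
  obtain ⟨π, hπ⟩ := v.valuation_exists_uniformizer K
  have hlt : ‖algebraMap K (v.adicCompletion K) (π ^ (e + 1))‖ < 1 := by
    refine he _ ?_
    rw [map_pow, hπ, ← WithZero.exp_nsmul, WithZero.exp_le_exp]
    simp
  have hπ0 : π ≠ 0 := by
    rintro rfl
    rw [map_zero] at hπ
    exact WithZero.exp_ne_zero hπ.symm
  let _ : NontriviallyNormedField (v.adicCompletion K) :=
    { (inferInstance : NormedField (v.adicCompletion K)) with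
      non_trivial := by
        refine ⟨(algebraMap K (v.adicCompletion K) (π ^ (e + 1)))⁻¹, ?_⟩
        rw [norm_inv]
        refine (one_lt_inv₀ (norm_pos_iff.2 ?_)).2 hlt
        simpa using hπ0 }
  have hW : WeaklyLocallyCompactSpace (v.adicCompletion K) := by
    refine ⟨fun x => ⟨(fun y => x + y) '' (v.adicCompletionIntegers K : Set (v.adicCompletion K)),
      (isCompact_adicCompletionIntegers v).image (by fun_prop), ?_⟩⟩
    have hopen : IsOpen (v.adicCompletionIntegers K : Set (v.adicCompletion K)) :=
      Valued.isOpen_valuationSubring _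
    exact ((Homeomorph.addLeft x).isOpenMap _ hopen).mem_nhds ⟨0, zero_mem _, add_zero x⟩
  exact ProperSpace.of_nontriviallyNormedField_of_weaklyLocallyCompactSpace _

instance (v : HeightOneSpectrum (𝓞 K)) : (finMeasure v).IsAddHaarMeasure := by
  unfold finMeasure
  infer_instance

instance (α : K) : (repMeasure α).IsAddHaarMeasure := by
  classical
  have : (Measure.pi fun v : FinPrimes α => finMeasure v.1).IsAddHaarMeasure := inferInstance
  exact Measure.prod.instIsAddHaarMeasure _ _

/-! ### The denominator ideal and valuations -/

/-- Otherwise `α` has a denominator outside the prime, yet that denominator belongs to `denIdeal α`.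
-/
theorem one_lt_valuation_of_dvd_denIdeal {α : K} {v : HeightOneSpectrum (𝓞 K)}
    (hv : v.asIdeal ∣ denIdeal α) : 1 < v.valuation K α := by
  by_contra! hle
  obtain ⟨y, s, hs⟩ := v.exists_primeCompl_mul_eq_of_integer α hle
  exact s.2 (Ideal.le_of_dvd hv ⟨y, by rw [mul_comm]; exact hs⟩)

theorem valuation_le_one_of_not_dvd_denIdeal {α : K} {v : HeightOneSpectrum (𝓞 K)}
    (hv : ¬v.asIdeal ∣ denIdeal α) : v.valuation K α ≤ 1 := by
  rw [Ideal.dvd_iff_le] at hv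
  obtain ⟨s, ⟨y, hy⟩, hs⟩ := SetLike.not_le_iff_exists.1 hv
  have h1 : v.valuation K (s : K) = 1 := by
    exact (v.valuation_eq_one_iff_notMem).2 hs
  have h2 : v.valuation K ((s : K) * α) ≤ 1 := by
    rw [hy]
    exact v.valuation_le_one y
  rwa [map_mul, h1, one_mul] at h2

theorem valuation_le_one_of_mem_ZAdjoin {α x : K} (hx : x ∈ ZAdjoin α)
    {v : HeightOneSpectrum (𝓞 K)} (hv : v.valuation K α ≤ 1) : v.valuation K x ≤ 1 := by
  induction hx using Algebra.adjoin_induction with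
  | mem x hx => rwa [Set.mem_singleton_iff.1 hx]
  | algebraMap r =>
    have := v.valuation_le_one (K := K) (r : 𝓞 K)
    simpa using this
  | add x y _ _ hx hy => exact (Valuation.map_add_le _ hx hy)
  | mul x y _ _ hx hy => rw [map_mul]; exact mul_le_one' hx hy

/-! ### Multiplication by `α` is expanding -/

theorem IsExpanding.one_lt_norm {α : K} (hα : IsExpanding α) (φ : K →+* ℂ) : 1 < ‖φ α‖ := by
  refine hα _ ?_
  have h1 := Polynomial.aeval_algHom_apply φ.toRatAlgHom α (minpoly ℚ α)
  rw [minpoly.aeval, map_zero] at h1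
  exact h1

theorem IsExpanding.ne_zero {α : K} (hα : IsExpanding α) : α ≠ 0 := by
  rintro rfl
  have := hα.one_lt_norm (Classical.arbitrary (K →+* ℂ))
  rw [map_zero, norm_zero] at this
  linarith

open scoped Classical in
theorem IsExpanding.norm_mixedEmbedding_inv_lt_one {α : K} (hα : IsExpanding α) :
    ‖mixedEmbedding K α⁻¹‖ < 1 := by
  rw [Prod.norm_def, max_lt_iff, pi_norm_lt_iff one_pos, pi_norm_lt_iff one_pos]
  refine ⟨fun w => ?_, fun w => ?_⟩
  · rw [mixedEmbedding.mixedEmbedding_apply_isReal, InfinitePlace.norm_embedding_of_isReal,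
      ← InfinitePlace.norm_embedding_eq, map_inv₀, norm_inv]
    exact inv_lt_one_of_one_lt₀ (hα.one_lt_norm _)
  · rw [mixedEmbedding.mixedEmbedding_apply_isComplex, map_inv₀, norm_inv]
    exact inv_lt_one_of_one_lt₀ (hα.one_lt_norm _)

/-- The diagonal embedding of `K` into the finite part of the representation space. -/
def finPhi (α : K) : K →+* FinPart α :=
  RingHom.pi fun v : FinPrimes α => algebraMap K (v.1.adicCompletion K)

theorem norm_finPhi_inv_lt_one (α : K) : ‖finPhi α α⁻¹‖ < 1 := by
  refine (pi_norm_lt_iff one_pos).2 fun v => ?_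
  change ‖algebraMap K (v.1.adicCompletion K) α⁻¹‖ < 1
  rw [norm_algebraMap_adicCompletion]
  have h1 : v.1.valuation K α⁻¹ < 1 := by
    rw [map_inv₀]
    exact inv_lt_one_of_one_lt₀ (one_lt_valuation_of_dvd_denIdeal v.2)
  exact_mod_cast (WithZeroMulInt.toNNReal_lt_one_iff
    (NumberField.HeightOneSpectrum.one_lt_absNorm_nnreal v.1)).2 h1

open scoped Classical in
theorem IsExpanding.norm_Phi_inv_lt_one {α : K} (hα : IsExpanding α) : ‖Phi α α⁻¹‖ < 1 :=
  max_lt hα.norm_mixedEmbedding_inv_lt_one (norm_finPhi_inv_lt_one α)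

/-! ### The image of `ℤ[α]` is a lattice -/

open scoped Classical in
-- Primes off `𝔟` are harmless for all of `ℤ[α]`, and the norm controls those dividing `𝔟`, so `x`
-- is an algebraic integer. A nonzero one cannot have absolute value less than 1 at every infinite
-- place.
theorem eq_zero_of_norm_Phi_lt_one {α x : K} (hx : x ∈ ZAdjoin α) (hn : ‖Phi α x‖ < 1) :
    x = 0 := by
  obtain ⟨h1, h2⟩ := max_lt_iff.1 (show max ‖mixedEmbedding K x‖ ‖finPhi α x‖ < 1 from hn)
  have hint : ∀ v : HeightOneSpectrum (𝓞 K), v.valuation K x ≤ 1 := by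
    intro v
    by_cases hv : v.asIdeal ∣ denIdeal α
    · exact (norm_algebraMap_adicCompletion_le_one_iff v x).1
        (((pi_norm_lt_iff one_pos).1 h2 ⟨v, hv⟩).le)
    · exact valuation_le_one_of_mem_ZAdjoin hx (valuation_le_one_of_not_dvd_denIdeal hv)
  obtain ⟨y, rfl⟩ := mem_integers_of_valuation_le_one K x hint
  have hw : ∀ w : InfinitePlace K, w (algebraMap (𝓞 K) K y) < 1 := by
    intro w
    rw [← mixedEmbedding.normAtPlace_apply]
    refine lt_of_le_of_lt ?_ h1
    rw [mixedEmbedding.norm_eq_sup'_normAtPlace]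
    exact Finset.le_sup' (fun w => mixedEmbedding.normAtPlace w _) (Finset.mem_univ w)
  by_contra hne
  have hy : y ≠ 0 := by
    rintro rfl
    exact hne (map_zero _)
  let w := Classical.arbitrary (InfinitePlace K)
  exact (hw w).not_ge (InfinitePlace.one_le_of_lt_one hy fun z _ => hw z)

theorem exists_intCast_mul_mem_ZAdjoin {α : K} (hK : IntermediateField.adjoin ℚ {α} = ⊤) (x : K) :
    ∃ n : ℤ, n ≠ 0 ∧ (n : K) * x ∈ ZAdjoin α := by
  have htop : Algebra.adjoin ℚ {α} = ⊤ := by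
    rw [← IntermediateField.adjoin_simple_toSubalgebra_of_isAlgebraic
      (Algebra.IsAlgebraic.isAlgebraic α), hK, IntermediateField.top_toSubalgebra]
  have hx : x ∈ Algebra.adjoin ℚ {α} := htop ▸ Algebra.mem_top
  have hint : ∀ n : ℤ, (n : K) ∈ ZAdjoin α := fun n => by
    simp
  induction hx using Algebra.adjoin_induction with
  | mem x hx => exact ⟨1, one_ne_zero, by simpa using Algebra.subset_adjoin hx⟩
  | algebraMap r =>
    refine ⟨r.den, by simp, ?_⟩
    have : ((r.den : ℤ) : K) * algebraMap ℚ K r = (r.num : ℤ) := by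
      rw [eq_ratCast]
      exact_mod_cast congrArg (Rat.cast : ℚ → K) (Rat.den_mul_eq_num r)
    rw [this]
    exact hint _
  | add x y _ _ hx hy =>
    obtain ⟨m, hm, hx⟩ := hx
    obtain ⟨n, hn, hy⟩ := hy
    refine ⟨m * n, mul_ne_zero hm hn, ?_⟩
    have : ((m * n : ℤ) : K) * (x + y) = n * (m * x) + m * (n * y) := by push_cast; ring
    rw [this]
    exact add_mem (mul_mem (hint _) hx) (mul_mem (hint _) hy)
  | mul x y _ _ hx hy =>
    obtain ⟨m, hm, hx⟩ := hx
    obtain ⟨n, hn, hy⟩ := hy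
    refine ⟨m * n, mul_ne_zero hm hn, ?_⟩
    have : ((m * n : ℤ) : K) * (x * y) = (m * x) * (n * y) := by push_cast; ring
    rw [this]
    exact mul_mem hx hy

theorem exists_forall_intCast_mul_mem_ZAdjoin {α : K}
    (hK : IntermediateField.adjoin ℚ {α} = ⊤) :
    ∃ n : ℤ, n ≠ 0 ∧ ∀ x : 𝓞 K, (n : K) * x ∈ ZAdjoin α := by
  choose n hn hmem using exists_intCast_mul_mem_ZAdjoin hK
  let B := RingOfIntegers.basis K
  refine ⟨∏ i, n (B i), Finset.prod_ne_zero_iff.2 fun i _ => hn _, fun x => ?_⟩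
  have hint : ∀ n : ℤ, (n : K) ∈ ZAdjoin α := fun n => by
    simp
  have hx : (x : K) = ∑ i, (B.repr x i : K) * (B i : K) := by
    conv_lhs => rw [← B.sum_repr x]
    simp
  rw [hx, Finset.mul_sum]
  refine sum_mem fun i hi => ?_
  classical
  rw [← Finset.prod_erase_mul _ _ hi]
  push_cast
  have : (∏ i ∈ Finset.univ.erase i, (n (B i) : K)) * (n (B i)) * ((B.repr x i : K) * (B i : K)) =
      (∏ i ∈ Finset.univ.erase i, (n (B i) : K)) * (B.repr x i : K) * (n (B i) * (B i : K)) := by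
    ring
  rw [this]
  exact mul_mem (mul_mem (prod_mem fun i _ => hint _) (hint _)) (hmem _)

/-- The ring of integers is dense in the product of finitely many rings of local integers. -/
theorem exists_int_norm_sub_finPhi_le {α : K} {y : FinPart α} (hy : ‖y‖ ≤ 1) {ε : ℝ}
    (hε : 0 < ε) : ∃ c : 𝓞 K, ‖y - finPhi α c‖ ≤ ε := by
  have hlocal : ∀ v : FinPrimes α, ∃ a : 𝓞 K, ∃ e : ℕ,
      ‖y v - algebraMap K (v.1.adicCompletion K) a‖ ≤ ε / 2 ∧
      ∀ x : K, v.1.valuation K x ≤ WithZero.exp (-(e : ℤ)) →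
        ‖algebraMap K (v.1.adicCompletion K) x‖ < ε / 2 := by
    intro v
    obtain ⟨e, he⟩ := exists_norm_lt_of_valuation_le (K := K) v.1 (half_pos hε)
    obtain ⟨e', he'⟩ := exists_norm_lt_of_valuation_le (K := K) v.1 (half_pos (half_pos hε))
    obtain ⟨k, hk⟩ := (denseRange_algebraMap K v.1).exists_dist_lt (y v)
      (lt_min (half_pos (half_pos hε)) one_pos)
    rw [dist_eq_norm, lt_min_iff] at hk
    have hk1 : v.1.valuation K k ≤ 1 := by
      rw [← norm_algebraMap_adicCompletion_le_one_iff,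
        ← mem_adicCompletionIntegers_iff_norm_le_one]
      have h1 : y v ∈ v.1.adicCompletionIntegers K :=
        (mem_adicCompletionIntegers_iff_norm_le_one _ _).2 ((norm_le_pi_norm y v).trans hy)
      have h2 := (mem_adicCompletionIntegers_iff_norm_le_one v.1 _).2 hk.2.le
      have h3 := sub_mem h1 h2
      rwa [sub_sub_cancel] at h3
    obtain ⟨a, ha⟩ := exists_valuation_sub_lt_of_integer v.1 hk1
      (Units.mk0 (WithZero.exp (-(e' : ℤ))) WithZero.exp_ne_zero)
    refine ⟨a, e, ?_, he⟩
    have h4 := he' _ ha.le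
    rw [map_sub] at h4
    have h5 : y v - algebraMap K (v.1.adicCompletion K) a =
        (y v - algebraMap K (v.1.adicCompletion K) k) -
        (algebraMap K (v.1.adicCompletion K) a - algebraMap K (v.1.adicCompletion K) k) := by
      ring
    rw [h5]
    linarith [norm_sub_le (y v - algebraMap K (v.1.adicCompletion K) k)
      (algebraMap K (v.1.adicCompletion K) a - algebraMap K (v.1.adicCompletion K) k), hk.1]
  choose a e ha he using hlocal
  -- The Chinese remainder theorem glues the local approximations `a v`, modulo powers high enough
  -- to cost at most `ε / 2` each.
  obtain ⟨c, hc⟩ := IsDedekindDomain.exists_forall_sub_mem_ideal (s := Finset.univ)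
    (fun v : FinPrimes α => v.1.asIdeal) e (fun v _ => v.1.prime)
    (fun v _ w _ hne heq => hne (Subtype.ext (HeightOneSpectrum.ext heq))) fun v => a v
  refine ⟨c, (pi_norm_le_iff_of_nonneg hε.le).2 fun v => ?_⟩
  have h1 : v.1.valuation K ((c : K) - a v) ≤ WithZero.exp (-(e v : ℤ)) := by
    have := (intValuation_le_pow_iff_mem v.1 _ _).2 (hc v (Finset.mem_univ v))
    rw [← valuation_of_algebraMap (K := K)] at this
    push_cast at this
    exact this
  have h2 := he v _ h1
  have h3 : (y - finPhi α c) v = (y v - algebraMap K (v.1.adicCompletion K) (a v)) -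
      algebraMap K (v.1.adicCompletion K) ((c : K) - a v) := by
    rw [map_sub]
    change y v - algebraMap K (v.1.adicCompletion K) c = _
    ring
  rw [h3]
  linarith [norm_sub_le (y v - algebraMap K (v.1.adicCompletion K) (a v))
    (algebraMap K (v.1.adicCompletion K) ((c : K) - a v)), ha v]

/-- Multiplying by `α⁻¹ ^ n * N⁻¹` shrinks `y` into the local integers, where some `c : 𝓞 K`
approximates it. Multiplying back lands in `ℤ[α]`, because `N` carries `𝓞 K` into `ℤ[α]`. -/
theorem exists_mem_ZAdjoin_norm_sub_finPhi_le {α : K} (hα : α ≠ 0)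
    (hK : IntermediateField.adjoin ℚ {α} = ⊤) (y : FinPart α) :
    ∃ x ∈ ZAdjoin α, ‖y - finPhi α x‖ ≤ 1 := by
  obtain ⟨N, hN, hmem⟩ := exists_forall_intCast_mul_mem_ZAdjoin hK
  have hN' : (N : K) ≠ 0 := Int.cast_ne_zero.2 hN
  obtain ⟨n, hn⟩ : ∃ n : ℕ, ‖finPhi α (α⁻¹ ^ n) * (finPhi α (N : K)⁻¹ * y)‖ ≤ 1 := by
    have ht : Filter.Tendsto (fun n : ℕ => ‖finPhi α α⁻¹‖ ^ n * ‖finPhi α (N : K)⁻¹ * y‖)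
        Filter.atTop (nhds (0 * ‖finPhi α (N : K)⁻¹ * y‖)) :=
      (tendsto_pow_atTop_nhds_zero_of_lt_one (norm_nonneg _)
        (norm_finPhi_inv_lt_one α)).mul_const _
    rw [zero_mul] at ht
    obtain ⟨n, hn⟩ := (ht.eventually (gt_mem_nhds one_pos)).exists
    refine ⟨n, ?_⟩
    rw [map_pow]
    exact (IsTileSystem.norm_pow_mul_le _ _ _).trans hn.le
  set C := ‖finPhi α (α ^ n * N)‖
  have hC : 0 < C + 1 := by positivity
  obtain ⟨c, hc⟩ := exists_int_norm_sub_finPhi_le hn (inv_pos.2 hC)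
  refine ⟨α ^ n * (N * c), mul_mem (pow_mem (Algebra.self_mem_adjoin_singleton ℤ α) n) (hmem c), ?_⟩
  have h1 : y - finPhi α (α ^ n * (N * c)) = finPhi α (α ^ n * N) *
      (finPhi α (α⁻¹ ^ n) * (finPhi α (N : K)⁻¹ * y) - finPhi α c) := by
    have h2 : finPhi α (α ^ n * N) * (finPhi α (α⁻¹ ^ n) * finPhi α (N : K)⁻¹) = 1 := by
      rw [← map_mul, ← map_mul, ← map_one (finPhi α)]
      congr 1
      rw [mul_mul_mul_comm, ← mul_pow, mul_inv_cancel₀ hα, one_pow, one_mul, mul_inv_cancel₀ hN']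
    rw [← mul_assoc (α ^ n), map_mul _ (α ^ n * (N : K))]
    linear_combination (-y) * h2
  rw [h1]
  calc _ ≤ C * (C + 1)⁻¹ := (norm_mul_le _ _).trans (mul_le_mul_of_nonneg_left hc (norm_nonneg _))
    _ ≤ 1 := by
      rw [← div_eq_mul_inv, div_le_one hC]
      linarith

open scoped Classical in
theorem exists_norm_sub_mixedEmbedding_le {N : ℤ} (hN : N ≠ 0) :
    ∃ R, ∀ z : mixedEmbedding.mixedSpace K, ∃ c : 𝓞 K,
      ‖z - mixedEmbedding K ((N : K) * c)‖ ≤ R := by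
  refine ⟨‖(N : ℝ)‖ * ∑ i, ‖mixedEmbedding.latticeBasis K i‖, fun z => ?_⟩
  set B := mixedEmbedding.latticeBasis K
  have hN' : (N : ℝ) ≠ 0 := Int.cast_ne_zero.2 hN
  have hmem := (ZSpan.floor B ((N : ℝ)⁻¹ • z)).2
  rw [mixedEmbedding.mem_span_latticeBasis] at hmem
  obtain ⟨c, hc⟩ := hmem
  refine ⟨c, ?_⟩
  have hc' : mixedEmbedding K (c : K) = (ZSpan.floor B ((N : ℝ)⁻¹ • z) : _) := hc
  have h1 : z - mixedEmbedding K ((N : K) * c) = (N : ℝ) • ZSpan.fract B ((N : ℝ)⁻¹ • z) := by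
    rw [ZSpan.fract_apply, smul_sub, smul_inv_smul₀ hN', map_mul, map_intCast, hc',
      Int.cast_smul_eq_zsmul, zsmul_eq_mul]
  rw [h1, norm_smul]
  exact mul_le_mul_of_nonneg_left (ZSpan.norm_fract_le _ _) (norm_nonneg _)

open scoped Classical in
-- The finite part is approximated first. The correction `N * c` then handles the infinite part and,
-- being integral, moves the finite part by at most 1.
theorem exists_forall_norm_sub_Phi_le {α : K} (hα : α ≠ 0)
    (hK : IntermediateField.adjoin ℚ {α} = ⊤) :
    ∃ R, ∀ z : RepSpace α, ∃ x ∈ ZAdjoin α, ‖z - Phi α x‖ ≤ R := by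
  obtain ⟨N, hN, hmem⟩ := exists_forall_intCast_mul_mem_ZAdjoin hK
  obtain ⟨R, hR⟩ := exists_norm_sub_mixedEmbedding_le (K := K) hN
  refine ⟨max R (1 + 1), fun z => ?_⟩
  obtain ⟨x, hx, hxz⟩ := exists_mem_ZAdjoin_norm_sub_finPhi_le hα hK z.2
  obtain ⟨c, hc⟩ := hR (z.1 - mixedEmbedding K x)
  refine ⟨x + N * c, add_mem hx (hmem c), max_le_max ?_ ?_⟩
  · change ‖z.1 - mixedEmbedding K (x + N * c)‖ ≤ R
    rwa [map_add, ← sub_sub]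
  · change ‖z.2 - finPhi α (x + N * c)‖ ≤ 1 + 1
    rw [map_add, ← sub_sub]
    refine (norm_sub_le _ _).trans (add_le_add hxz ?_)
    refine (pi_norm_le_iff_of_nonneg zero_le_one).2 fun v => ?_
    have := norm_algebraMap_adicCompletion_int_le_one v.1 ((N : 𝓞 K) * c)
    rwa [RingOfIntegers.coe_eq_algebraMap, map_mul, map_intCast] at this

/-! ### The tile system of an expanding algebraic number -/

theorem Phi_injective (α : K) : Function.Injective (Phi α) := (Phi α).injective

open scoped Classical in
theorem isTileSystem {α : K} (hK : IntermediateField.adjoin ℚ {α} = ⊤) (hα : IsExpanding α)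
    {D : Set K} (hD : IsStandardDigitSet α D) :
    IsTileSystem (Phi α α) (Phi α α⁻¹)
      ((ZAdjoin α).toSubring.toAddSubgroup.map (Phi α : K →+ RepSpace α)) (Phi α '' D) where
  mul_eq_one := by rw [← map_mul, mul_inv_cancel₀ hα.ne_zero, map_one]
  norm_lt_one := hα.norm_Phi_inv_lt_one
  discrete := by
    refine ⟨1, one_pos, ?_⟩
    rintro _ ⟨x, hx, rfl⟩ hn
    rw [eq_zero_of_norm_Phi_lt_one hx hn, map_zero]
  cocompact := by
    obtain ⟨R, hR⟩ := exists_forall_norm_sub_Phi_le hα.ne_zero hK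
    refine ⟨R, fun z => ?_⟩
    obtain ⟨x, hx, hxz⟩ := hR z
    exact ⟨_, ⟨x, hx, rfl⟩, hxz⟩
  mul_mem := by
    rintro _ ⟨x, hx, rfl⟩
    exact ⟨α * x, (ZAdjoin α).mul_mem (Algebra.self_mem_adjoin_singleton ℤ α) hx,
      map_mul (Phi α) _ _⟩
  digits_subset := by
    rintro _ ⟨d, hd, rfl⟩
    exact ⟨d, hD.1 hd, rfl⟩
  existsUnique_digit := by
    rintro _ ⟨x, hx, rfl⟩
    obtain ⟨d, ⟨hd, y, hy, e⟩, huniq⟩ := hD.2 x hx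
    refine ⟨Phi α d, ⟨⟨d, hd, rfl⟩, Phi α y, ⟨y, hy, rfl⟩, ?_⟩, ?_⟩
    · rw [← map_mul, ← e, map_sub]
      rfl
    · rintro _ ⟨⟨d', hd', rfl⟩, _, ⟨y', hy', rfl⟩, e'⟩
      rw [huniq d' ⟨hd', y', hy', Phi_injective α ?_⟩]
      rw [map_sub, map_mul]
      exact e'

open scoped Classical in
theorem tile_eq_digitSums (α : K) (D : Set K) :
    tile α D = digitSums (Phi α α⁻¹) (Phi α '' D) := by
  ext z
  have hterm : ∀ k d, Phi α (d * (α ^ (k + 1))⁻¹) = Phi α α⁻¹ ^ (k + 1) * Phi α d := by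
    intro k d
    rw [← map_pow, ← map_mul, inv_pow, mul_comm]
  constructor
  · rintro ⟨d, hd, hz⟩
    refine ⟨fun k => Phi α (d k), fun k => ⟨_, hd k, rfl⟩, ?_⟩
    simpa only [hterm] using hz
  · rintro ⟨d, hd, hz⟩
    choose d' hd' hdd using hd
    refine ⟨d', hd', ?_⟩
    simpa only [hterm, hdd] using hz

end RationalTile

end

open RationalTile in
theorem theorem1 {K : Type*} [Field K] [NumberField K] (α : K)
    (hK : IntermediateField.adjoin ℚ {α} = ⊤) (hα : IsExpanding α)
    (D : Set K) (hD : IsStandardDigitSet α D) :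
    (IsRationalSelfAffineTile α D (tile α D) ∧
      ∀ G : Set (RepSpace α), G.Nonempty → IsCompact G → SetEquation α D G → G = tile α D) ∧
    IsCompact (tile α D) ∧
    tile α D = closure (interior (tile α D)) ∧
    repMeasure α (frontier (tile α D)) = 0 ∧
    IsMultipleTiling (repMeasure α)
      {T : Set (RepSpace α) | ∃ x ∈ ZAdjoin α, T = (fun z => z + Phi α x) '' tile α D} := by
  classical
  have h := isTileSystem hK hα hD
  have hset : ∀ G : Set (RepSpace α), SetEquation α D G ↔
      (fun z => Phi α α * z) '' G = ⋃ d ∈ Phi α '' D, (fun z => z + d) '' G := by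
    intro G
    rw [SetEquation, Set.biUnion_image]
  rw [tile_eq_digitSums]
  refine ⟨⟨⟨h.digitSums_nonempty, h.isCompact_digitSums, (hset _).2 h.mul_digitSums,
    h.measure_digitSums_pos _⟩, fun G hne hG hGset => h.eq_digitSums hne hG ((hset G).1 hGset)⟩,
    h.isCompact_digitSums, h.closure_interior_digitSums, h.measure_frontier_digitSums _, ?_⟩
  have htiling := h.isMultipleTiling (repMeasure α) ?_
  · have hC : {T : Set (RepSpace α) | ∃ x ∈ ZAdjoin α, T = (fun z => z + Phi α x) ''
          digitSums (Phi α α⁻¹) (Phi α '' D)} =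
        {T | ∃ x ∈ (ZAdjoin α).toSubring.toAddSubgroup.map (Phi α : K →+ RepSpace α),
          T = (fun z => z + x) '' digitSums (Phi α α⁻¹) (Phi α '' D)} := by
      ext T
      constructor
      · rintro ⟨x, hx, rfl⟩
        exact ⟨_, ⟨x, hx, rfl⟩, rfl⟩
      · rintro ⟨_, ⟨x, hx, rfl⟩, rfl⟩
        exact ⟨x, hx, rfl⟩
    rw [hC]
    exact htiling
  -- `Phi α` is injective and `K` has characteristic zero, so the lattice is torsion-free.
  · rintro _ ⟨x, -, rfl⟩ n hn hnx
    have h1 : Phi α (n • x) = Phi α 0 := by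
      rw [map_nsmul, map_zero]
      exact hnx
    have h2 := Phi_injective α h1
    rw [smul_eq_zero_iff_right hn] at h2
    rw [h2, map_zero]
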